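/- Let $0<\rho<1$. Jobs arrive according to a Poisson process of rate $2\rho$ at two parallel single-server queues with exponential service times of rate $1$; an arriving job joins the shorter queue, and either queue with probability $1/2$ in case of a tie. Let $X=(X_1,X_2)$ be the Markov process of queue lengths on $\mathbb N_0^2$ and $Y=(\min(X_1,X_2),\,X_2-X_1)$ the same process in the state space $\mathbb N_0\times\mathbb Z$. An equilibrium distribution is a probability distribution that solves the global balance equations (for every state, flow out equals flow in). Call the following equations for a function $f(m,n)$, $m\ge 0$, $n\ge 1$, the reduced balance equations: (I) $2(1+\rho)f(m,n)=2\rho f(m-1,n+1)+f(m,n+1)+f(m+1,n-1)$ for $m\ge1,n\ge2$; (V) $(1+2\rho)f(0,n)=f(0,n+1)+f(1,n-1)$ for $n\ge2$; (H) $2(1+\rho)f(m,1)=2\rho f(m-1,2)+f(m,2)+\frac{\rho}{1+\rho}\bigl(2\rho f(m-1,1)+f(m,1)\bigr)+\frac1{1+\rho}\bigl(2\rho f(m,1)+f(m+1,1)\bigr)$ for $m\ge1$; (O) $(1+2\rho)f(0,1)=f(0,2)+\frac1{1+\rho}\bigl(2\rho f(0,1)+f(1,1)\bigr)+f(0,1)$.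 A product form $\alpha^m\beta^n$ with $\alpha,\beta\neq0$ satisfies (I) if and only if $$(\ast)\qquad \alpha^2+2\rho\beta^2+\alpha\beta^2-2(1+\rho)\alpha\beta=0 .$$ Compensation procedure: put $h_0=1$, $\alpha_0=\rho^2$, $\beta_0=\rho^2/(2+\rho)$, and for $i\ge0$ let $\alpha_{i+1}$ be the root $\alpha$ of $(\ast)$ for $\beta=\beta_i$ with $|\alpha_{i+1}|<|\beta_i|$, let $\beta_{i+1}$ be the root $\beta$ of $(\ast)$ for $\alpha=\alpha_{i+1}$ with $|\beta_{i+1}|<|\alpha_{i+1}|$, and $$v_i=-\frac{\alpha_{i+1}-\beta_i}{\alpha_i-\beta_i}\,h_i,\qquad h_{i+1}=-\frac{(\rho+\alpha_{i+1})/\beta_{i+1}-(1+\rho)}{(\rho+\alpha_{i+1})/\beta_i-(1+\rho)}\,v_i .$$ Put $\theta_\pm=1+\rho\pm\sqrt{1+\rho^2}$. Then: 1. The procedure is well defined and determines the four real sequences uniquely: $1>\alpha_0>\beta_0>\alpha_1>\beta_1>\dots>0$, each $\alpha_{i+1}$ (resp. $\beta_i$) is the only complex root of $(\ast)$ for $\beta=\beta_i$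 (resp. $\alpha=\alpha_i$) in the open disc of radius $\beta_i$ (resp. $\alpha_i$), the denominators above do not vanish, and $h_i,v_i\ne0$. 2. $h_0\alpha_0^m\beta_0^n$ satisfies (I) and (H); for every $i\ge 0$, $h_i\alpha_i^m\beta_i^n+v_i\alpha_{i+1}^m\beta_i^n$ satisfies (I) and (V), and $v_i\alpha_{i+1}^m\beta_i^n+h_{i+1}\alpha_{i+1}^m\beta_{i+1}^n$ satisfies (I) and (H). 3. For $m\ge0$, $n\ge1$, $$\lim_{i\to\infty}\left|\frac{h_{i+1}\alpha_{i+1}^m\beta_{i+1}^n}{h_i\alpha_i^m\beta_i^n}\right|=\lim_{i\to\infty}\left|\frac{v_{i+1}\alpha_{i+2}^m\beta_{i+1}^n}{v_i\alpha_{i+1}^m\beta_i^n}\right|=\frac{1-\theta_-}{\theta_+-1}\Bigl(\frac{\theta_-}{\theta_+}\Bigr)^{m+n-1}<1,$$ and the ratios of consecutive terms of $\frac{|h_i|}{1-|\alpha_i|}\frac{|\beta_i|}{1-|\beta_i|}$ and of $\frac{|v_i|}{1-|\alpha_{i+1}|}\frac{|\beta_i|}{1-|\beta_i|}$ both tend to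 $\frac{1-\theta_-}{\theta_+-1}<1$. Hence for $m\ge0,n\ge1$ the two series in $$s(m,n)=\sum_{i\ge0}h_i\alpha_i^m\beta_i^n+\sum_{i\ge0}v_i\alpha_{i+1}^m\beta_i^n$$ converge absolutely, also when summed over all $m\ge0$, $n\ge1$. 4. $s$ is not identically zero, satisfies all reduced balance equations, and is, up to a multiplicative constant, their only solution with $\sum_{m\ge0,n\ge1}|f(m,n)|<\infty$. 5. $X$ and $Y$ each have a unique equilibrium distribution, and these correspond to each other under the bijection of the state spaces. That of $Y$ is given by $$p(m,n)=C^{-1}\sum_{i\ge0}(h_i\alpha_i^m+v_i\alpha_{i+1}^m)\beta_i^n,\qquad m\ge0,\ n\ge1,$$ $p(m,-n)=p(m,n)$, $p(m,0)=\frac{2\rho\,p(m-1,1)+p(m,1)}{1+\rho}$ for $m\ge1$, and $p(0,0)=p(0,1)/\rho$, where $$C=\frac{\rho(2+\rho)}{2(1-\rho^2)(2-\rho)} .$$ Here $C$ is the sum over all states in $\mathbb N_0\times\mathbb Z$ of the extension of $s$ by the same three rules. -/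

import Mathlib

open Filter Topology

namespace JSQ

noncomputable section

/-! ### Markov processes on a countable state space, given by transition rates -/

/-- `p` satisfies the (global) balance equations of the Markov process with transition rates `q`:
for every state `y`, the flow out of `y` equals the flow into `y`.  (A diagonal term `q y y`
contributes `p y * q y y` to both sides, so it is irrelevant; it is zero below.) -/
def SatisfiesBalance {S : Type*} (q : S → S → ℝ) (p : S → ℝ) : Prop :=
  ∀ y, HasSum (fun x => p x * q x y) (p y * ∑' z, q y z)

/-- An equilibrium distribution: a probability distribution that solves the balance equations. -/
structure IsEquilibrium {S : Type*} (q : S → S → ℝ) (p : S → ℝ) : Prop where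
  nonneg : ∀ x, 0 ≤ p x
  hasSum_one : HasSum p 1
  balance : SatisfiesBalance q p

/-! ### The symmetric join-the-shortest-queue system -/

/-- Rate at which arriving jobs join a queue of length `own` when the other queue has length
`other`: the total arrival rate is `2ρ`, the shorter queue is joined, ties are split evenly. -/
def joinRate (ρ : ℝ) (own other : ℕ) : ℝ :=
  if own < other then 2 * ρ else if own = other then ρ else 0

/-- Transition rates of the queue lengths `X = (X₁, X₂)`; each server works at rate `1`. -/
def rateX (ρ : ℝ) (x y : ℕ × ℕ) : ℝ :=
  (if y = (x.1 + 1, x.2) then joinRate ρ x.1 x.2 else 0) +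
  (if y = (x.1, x.2 + 1) then joinRate ρ x.2 x.1 else 0) +
  (if x = (y.1 + 1, y.2) then 1 else 0) +
  (if x = (y.1, y.2 + 1) then 1 else 0)

/-- The change of state description `(X₁, X₂) ↦ (Y₁, Y₂) = (min X₁ X₂, X₂ - X₁)`. -/
def toMinDiff : ℕ × ℕ ≃ ℕ × ℤ where
  toFun x := (min x.1 x.2, (x.2 : ℤ) - (x.1 : ℤ))
  invFun y := (y.1 + (-y.2).toNat, y.1 + y.2.toNat)
  left_inv := by
    rintro ⟨i, j⟩
    ext <;> simp <;> omega
  right_inv := by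
    rintro ⟨m, n⟩
    ext <;> simp <;> omega

/-- Transition rates of `Y = (min X₁ X₂, X₂ - X₁)`. -/
def rateY (ρ : ℝ) (x y : ℕ × ℤ) : ℝ := rateX ρ (toMinDiff.symm x) (toMinDiff.symm y)

/-! ### Balance equations for the states `(m, n)` with `m ≥ 0`, `n ≥ 1` -/

/-- Balance equations of the interior. -/
def InteriorBalance (ρ : ℝ) (f : ℕ → ℕ → ℝ) : Prop :=
  ∀ m n : ℕ, 1 ≤ m → 2 ≤ n →
    2 * (1 + ρ) * f m n = 2 * ρ * f (m - 1) (n + 1) + f m (n + 1) + f (m + 1) (n - 1)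

/-- Balance equations of the vertical boundary. -/
def VerticalBalance (ρ : ℝ) (f : ℕ → ℕ → ℝ) : Prop :=
  ∀ n : ℕ, 2 ≤ n → (1 + 2 * ρ) * f 0 n = f 0 (n + 1) + f 1 (n - 1)

/-- Balance equations of the horizontal boundary (with the states `(m, 0)` eliminated). -/
def HorizontalBalance (ρ : ℝ) (f : ℕ → ℕ → ℝ) : Prop :=
  ∀ m : ℕ, 1 ≤ m →
    2 * (1 + ρ) * f m 1 = 2 * ρ * f (m - 1) 2 + f m 2
      + ρ / (1 + ρ) * (2 * ρ * f (m - 1) 1 + f m 1)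
      + 1 / (1 + ρ) * (2 * ρ * f m 1 + f (m + 1) 1)

/-- Balance equation of the state `(0, 1)` (with the states `(m, 0)` eliminated). -/
def CornerBalance (ρ : ℝ) (f : ℕ → ℕ → ℝ) : Prop :=
  (1 + 2 * ρ) * f 0 1 = f 0 2 + 1 / (1 + ρ) * (2 * ρ * f 0 1 + f 1 1) + f 0 1

/-- Extension of values on `{m ≥ 0, n ≥ 1}` to all of `ℕ × ℤ`, through the balance equations
of the states `(m, 0)` and the symmetry `p(m, n) = p(m, -n)`. -/
def extend (ρ : ℝ) (f : ℕ → ℕ → ℝ) (s : ℕ × ℤ) : ℝ :=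
  if s.2 = 0 then
    if s.1 = 0 then f 0 1 / ρ else (2 * ρ * f (s.1 - 1) 1 + f s.1 1) / (1 + ρ)
  else f s.1 s.2.natAbs

/-! ### The compensation procedure -/

/-- The condition on `(α, β)` under which `α ^ m * β ^ n` solves the interior equations. -/
def InteriorCurve {K : Type*} [Field K] (ρ α β : K) : Prop :=
  α ^ 2 + 2 * ρ * β ^ 2 + α * β ^ 2 - 2 * (1 + ρ) * α * β = 0

/-- The four sequences generated by the compensation procedure. -/
structure Params where
  α : ℕ → ℝ
  β : ℕ → ℝ
  h : ℕ → ℝ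
  v : ℕ → ℝ

/-- `P` is generated by the compensation procedure: it starts from
`α₀ = ρ²`, `β₀ = ρ² / (2 + ρ)`, `h₀ = 1` and alternates vertical steps
(producing `α_{i+1}`, `v_i`) and horizontal steps (producing `β_{i+1}`, `h_{i+1}`). -/
structure IsCompensation (ρ : ℝ) (P : Params) : Prop where
  α_zero : P.α 0 = ρ ^ 2
  β_zero : P.β 0 = ρ ^ 2 / (2 + ρ)
  h_zero : P.h 0 = 1
  α_succ : ∀ i, InteriorCurve ρ (P.α (i + 1)) (P.β i) ∧ |P.α (i + 1)| < |P.β i|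
  v_eq : ∀ i, P.v i = -((P.α (i + 1) - P.β i) / (P.α i - P.β i)) * P.h i
  β_succ : ∀ i, InteriorCurve ρ (P.α (i + 1)) (P.β (i + 1)) ∧ |P.β (i + 1)| < |P.α (i + 1)|
  h_succ : ∀ i, P.h (i + 1) =
    -(((ρ + P.α (i + 1)) / P.β (i + 1) - (1 + ρ)) / ((ρ + P.α (i + 1)) / P.β i - (1 + ρ))) * P.v i

/-- The `i`-th term `h_i α_i^m β_i^n`. -/
def Params.hTerm (P : Params) (i m n : ℕ) : ℝ := P.h i * P.α i ^ m * P.β i ^ n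

/-- The `i`-th term `v_i α_{i+1}^m β_i^n`. -/
def Params.vTerm (P : Params) (i m n : ℕ) : ℝ := P.v i * P.α (i + 1) ^ m * P.β i ^ n

/-- The unnormalized series `∑ h_i α_i^m β_i^n + ∑ v_i α_{i+1}^m β_i^n`. -/
def Params.series (P : Params) (m n : ℕ) : ℝ :=
  (∑' i, P.hTerm i m n) + (∑' i, P.vTerm i m n)

/-- `θ₊ = 1 + ρ + √(1 + ρ²)`. -/
def thetaPlus (ρ : ℝ) : ℝ := 1 + ρ + Real.sqrt (1 + ρ ^ 2)

/-- `θ₋ = 1 + ρ - √(1 + ρ²)`. -/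
def thetaMinus (ρ : ℝ) : ℝ := 1 + ρ - Real.sqrt (1 + ρ ^ 2)

/-- The normalization constant. -/
def normConst (ρ : ℝ) : ℝ := ρ * (2 + ρ) / (2 * (1 - ρ ^ 2) * (2 - ρ))

end

end JSQ

namespace JSQ

/-! ### Balance equations on a countable state space -/

section Chain

variable {S T : Type*}

/-! Product forms on the curve (∗) satisfy (I). By Vieta, two of them with the same `β` combine so
that their defects in (V) cancel, and two with the same `α` so that their defects in (H) cancel
(`verticalBalance_pair`, `horizontalBalance_pair`). The point `(ρ², ρ²/(2+ρ))` satisfies (H) without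
a partner. Adding partners alternately from there gives a series whose terms satisfy (V) when
grouped in one way and (H) when grouped in the other. The roots decrease geometrically, and the
absolute ratio of consecutive terms has limit below 1, so both groupings are legitimate. Equation
(O) is then automatic: the defects of all states sum to zero, and only two states, equal by
symmetry, could contribute (`cornerBalance_of_others`).

Uniqueness does not depend on the form of the solution. The rates are bounded, so if `p` is a
summable solution then so is `|p|`. Hence `|p| + p` is a nonnegative solution, and by irreducibility
it vanishes everywhere or nowhere. Summable solutions therefore have constant sign, and one with
total zero vanishes (`SatisfiesBalance.eq_zero_of_hasSum_zero`). The signs of the individual terms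
are never examined: the extended series is nonnegative because its total `C` is positive.

The value of `C` comes from summation by parts against two test functions (`tsum_defect_mul_fold`).
The first expresses the total mass as a weighted sum over the states with an idle server. The second
is `ρ^(-N)`, with `N` the number of jobs. It evaluates that boundary sum for the series without its
first term, whose defect is explicit. The first term must be removed because `α₀ = ρ²` makes its
product with `ρ^(-N)` non-summable. -/

theorem satisfiesBalance_comp_equiv (e : S ≃ T) (q : T → T → ℝ) (p : T → ℝ) :
    SatisfiesBalance (fun x y => q (e x) (e y)) (p ∘ e) ↔ SatisfiesBalance q p := by
  unfold SatisfiesBalance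
  rw [e.forall_congr_left]
  refine forall_congr' fun y => ?_
  rw [← e.hasSum_iff, ← e.tsum_eq (fun z => q y z)]
  simp [Function.comp_def]

theorem isEquilibrium_comp_equiv (e : S ≃ T) (q : T → T → ℝ) (p : T → ℝ) :
    IsEquilibrium (fun x y => q (e x) (e y)) (p ∘ e) ↔ IsEquilibrium q p := by
  constructor
  · rintro ⟨h1, h2, h3⟩
    exact ⟨fun x => by simpa using h1 (e.symm x), e.hasSum_iff.1 h2,
      (satisfiesBalance_comp_equiv e q p).1 h3⟩
  · rintro ⟨h1, h2, h3⟩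
    exact ⟨fun x => h1 (e x), e.hasSum_iff.2 h2, (satisfiesBalance_comp_equiv e q p).2 h3⟩

theorem SatisfiesBalance.add {q : S → S → ℝ} {p p' : S → ℝ} (h : SatisfiesBalance q p)
    (h' : SatisfiesBalance q p') : SatisfiesBalance q (fun x => p x + p' x) := fun y => by
  simpa only [add_mul] using (h y).add (h' y)

theorem SatisfiesBalance.const_mul {q : S → S → ℝ} {p : S → ℝ} (h : SatisfiesBalance q p)
    (c : ℝ) : SatisfiesBalance q (fun x => c * p x) := fun y => by
  simpa only [mul_assoc] using (h y).mul_left c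

/-- For bounded rates, the absolute value of a summable solution of the balance equations
is a solution as well. -/
theorem SatisfiesBalance.abs {q : S → S → ℝ} {p : S → ℝ} {M : ℝ} (hq : ∀ x y, 0 ≤ q x y)
    (hs : ∀ x, Summable (q x)) (hM : ∀ x, ∑' y, q x y ≤ M) (hp : Summable p)
    (h : SatisfiesBalance q p) : SatisfiesBalance q (fun x => |p x|) := by
  -- The total flow is at most `M * ∑ |p x|`; this permits interchanging the sums over source and
  -- target.
  have hpair : Summable (fun t : S × S => |p t.1| * q t.1 t.2) := by
    have hnn : 0 ≤ fun t : S × S => |p t.1| * q t.1 t.2 :=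
      fun t => mul_nonneg (abs_nonneg _) (hq _ _)
    rw [summable_prod_of_nonneg hnn]
    refine ⟨fun x => (hs x).mul_left |p x|, ?_⟩
    simp only [tsum_mul_left]
    refine Summable.of_nonneg_of_le (fun x => mul_nonneg (abs_nonneg _) (tsum_nonneg (hq x)))
      (fun x => mul_le_mul_of_nonneg_left (hM x) (abs_nonneg _)) (hp.abs.mul_right M)
  have hcol : ∀ y, Summable (fun x => |p x| * q x y) := fun y => by
    simpa using hpair.prod_symm.prod_factor y
  have hb : HasSum (fun y => ∑' x, |p x| * q x y) (∑' x, |p x| * ∑' y, q x y) := by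
    have h1 : Summable (fun y => ∑' x, |p x| * q x y) := hpair.prod_symm.prod
    have h2 : ∑' y, ∑' x, |p x| * q x y = ∑' x, |p x| * ∑' y, q x y := by
      rw [Summable.tsum_comm (f := fun x y => |p x| * q x y) hpair]
      simp only [tsum_mul_left]
    exact h2 ▸ h1.hasSum
  have ha : HasSum (fun x => |p x| * ∑' y, q x y) (∑' x, |p x| * ∑' y, q x y) := by
    have := hpair.prod
    simp only [tsum_mul_left] at this
    exact this.hasSum
  -- Triangle inequality in the balance equation at `y`: under `|p|` the inflow is at least the
  -- outflow.
  have hle : ∀ y, 0 ≤ (∑' x, |p x| * q x y) - |p y| * ∑' z, q y z := fun y => by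
    have h1 : |p y| * ∑' z, q y z = |∑' x, p x * q x y| := by
      rw [(h y).tsum_eq, abs_mul, abs_of_nonneg (tsum_nonneg (hq y))]
    have h2 : (fun x => ‖p x * q x y‖) = fun x => |p x| * q x y := by
      ext x; rw [Real.norm_eq_abs, abs_mul, abs_of_nonneg (hq x y)]
    have h3 := norm_tsum_le_tsum_norm (f := fun x => p x * q x y) (by rw [h2]; exact hcol y)
    rw [h2, Real.norm_eq_abs] at h3
    linarith
  -- Total inflow and total outflow are the same double sum, so the nonnegative excesses sum to zero
  -- and each of them vanishes.
  have hz := hb.sub ha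
  rw [sub_self, hasSum_zero_iff_of_nonneg hle] at hz
  intro y
  have := congrFun hz y
  simp only [Pi.zero_apply] at this
  rw [← sub_eq_zero.1 this]
  exact (hcol y).hasSum

/-- If a nonnegative solution of the balance equations with a zero vanishes, then every summable
solution has constant sign. -/
theorem SatisfiesBalance.nonneg_or_nonpos {q : S → S → ℝ} {p : S → ℝ} {M : ℝ}
    (hq : ∀ x y, 0 ≤ q x y) (hs : ∀ x, Summable (q x)) (hM : ∀ x, ∑' y, q x y ≤ M)
    (hirr : ∀ p : S → ℝ, (∀ x, 0 ≤ p x) → SatisfiesBalance q p → ∀ x, p x = 0 → ∀ y, p y = 0)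
    (hp : Summable p) (h : SatisfiesBalance q p) : (∀ x, 0 ≤ p x) ∨ ∀ x, p x ≤ 0 := by
  -- The solution `|p| + p` is zero exactly where `p ≤ 0`, so a single such state forces `p ≤ 0`
  -- everywhere.
  have hpos := (h.abs hq hs hM hp).add h
  by_cases hx : ∃ x, |p x| + p x = 0
  · obtain ⟨x, hx⟩ := hx
    right
    intro y
    have := hirr _ (fun x => by linarith [neg_abs_le (p x)]) hpos x hx y
    linarith [abs_nonneg (p y)]
  · left
    intro x
    by_contra hneg
    exact hx ⟨x, by rw [abs_of_neg (not_le.1 hneg)]; ring⟩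

/-- A function of constant sign with total zero vanishes. Uniqueness follows by applying this to the
difference of two solutions with equal totals. -/
theorem SatisfiesBalance.eq_zero_of_hasSum_zero {q : S → S → ℝ} {p : S → ℝ} {M : ℝ}
    (hq : ∀ x y, 0 ≤ q x y) (hs : ∀ x, Summable (q x)) (hM : ∀ x, ∑' y, q x y ≤ M)
    (hirr : ∀ p : S → ℝ, (∀ x, 0 ≤ p x) → SatisfiesBalance q p → ∀ x, p x = 0 → ∀ y, p y = 0)
    (hp : HasSum p 0) (h : SatisfiesBalance q p) (x : S) : p x = 0 := by
  rcases h.nonneg_or_nonpos hq hs hM hirr hp.summable with h' | h'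
  · exact congrFun ((hasSum_zero_iff_of_nonneg h').1 hp) x
  · have := (hasSum_zero_iff_of_nonneg (f := fun x => - p x) (fun x => by
      simpa using h' x)).1 (by simpa using hp.neg)
    simpa using congrFun this x

/-- Exchange of summation between a measure and a test function. -/
theorem tsum_inflow_mul_eq {q : S → S → ℝ} {p φ Φ : S → ℝ} {M : ℝ} (hq : ∀ x y, 0 ≤ q x y)
    (hs : ∀ x, Summable (fun y => q x y * |φ y|))
    (hM : ∀ x, ∑' y, q x y * |φ y| ≤ M * Φ x) (hp : Summable (fun x => |p x| * Φ x)) :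
    Summable (fun y => (∑' x, p x * q x y) * φ y) ∧
    Summable (fun x => p x * ∑' y, q x y * φ y) ∧
    ∑' y, (∑' x, p x * q x y) * φ y = ∑' x, p x * ∑' y, q x y * φ y := by
  have hpair : Summable (fun t : S × S => p t.1 * (q t.1 t.2 * φ t.2)) := by
    refine Summable.of_norm ?_
    have h2 : (fun t : S × S => ‖p t.1 * (q t.1 t.2 * φ t.2)‖)
        = fun t => |p t.1| * (q t.1 t.2 * |φ t.2|) := by
      ext t; rw [Real.norm_eq_abs, abs_mul, abs_mul, abs_of_nonneg (hq _ _)]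
    have hnn : 0 ≤ fun t : S × S => |p t.1| * (q t.1 t.2 * |φ t.2|) :=
      fun t => mul_nonneg (abs_nonneg _) (mul_nonneg (hq _ _) (abs_nonneg _))
    rw [h2, summable_prod_of_nonneg hnn]
    refine ⟨fun x => (hs x).mul_left |p x|, ?_⟩
    simp only [tsum_mul_left]
    refine Summable.of_nonneg_of_le (fun x => mul_nonneg (abs_nonneg _)
      (tsum_nonneg fun y => mul_nonneg (hq x y) (abs_nonneg _)))
      (fun x => (mul_le_mul_of_nonneg_left (hM x) (abs_nonneg _)).trans_eq ?_) (hp.mul_left M)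
    ring
  have e1 : ∀ y, ∑' x, p x * (q x y * φ y) = (∑' x, p x * q x y) * φ y := fun y => by
    rw [← tsum_mul_right]; simp only [mul_assoc]
  refine ⟨?_, ?_, ?_⟩
  · have := hpair.prod_symm.prod
    simpa [e1] using this
  · simpa only [tsum_mul_left] using hpair.prod
  · rw [← tsum_congr e1, Summable.tsum_comm (f := fun x y => p x * (q x y * φ y)) hpair]
    simp only [tsum_mul_left]

end Chain

end JSQ

namespace JSQ

noncomputable section

/-! ### The flows of the queue length process -/

theorem hasSum_ite_eq_succ_fst (g : ℕ × ℕ → ℝ) (y : ℕ × ℕ) :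
    HasSum (fun x : ℕ × ℕ => if y = (x.1 + 1, x.2) then g x else 0)
      (if y.1 = 0 then 0 else g (y.1 - 1, y.2)) := by
  obtain ⟨i, j⟩ := y
  cases i with
  | zero => simp [hasSum_zero]
  | succ i =>
    convert hasSum_single ((i, j) : ℕ × ℕ) ?_ using 1
    · simp
    · rintro ⟨k, l⟩ hkl
      rw [if_neg]
      simp only [Prod.mk.injEq, not_and, ne_eq] at hkl ⊢
      omega

theorem hasSum_ite_eq_succ_snd (g : ℕ × ℕ → ℝ) (y : ℕ × ℕ) :
    HasSum (fun x : ℕ × ℕ => if y = (x.1, x.2 + 1) then g x else 0)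
      (if y.2 = 0 then 0 else g (y.1, y.2 - 1)) := by
  obtain ⟨i, j⟩ := y
  cases j with
  | zero => simp [hasSum_zero]
  | succ j =>
    convert hasSum_single ((i, j) : ℕ × ℕ) ?_ using 1
    · simp
    · rintro ⟨k, l⟩ hkl
      rw [if_neg]
      simp only [Prod.mk.injEq, not_and, ne_eq] at hkl ⊢
      omega

theorem hasSum_ite_eq_right (g : ℕ × ℕ → ℝ) (y : ℕ × ℕ) :
    HasSum (fun x : ℕ × ℕ => if x = y then g x else 0) (g y) := by
  convert hasSum_single y ?_ using 1
  · simp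
  · intro x hx
    simp [hx]

/-- The flow into the state `y` under the weights `P`. -/
def inflow (ρ : ℝ) (P : ℕ × ℕ → ℝ) (y : ℕ × ℕ) : ℝ :=
  (if y.1 = 0 then 0 else P (y.1 - 1, y.2) * joinRate ρ (y.1 - 1) y.2) +
  (if y.2 = 0 then 0 else P (y.1, y.2 - 1) * joinRate ρ (y.2 - 1) y.1) +
  P (y.1 + 1, y.2) + P (y.1, y.2 + 1)

/-- The action of the jumps of the process on the function `φ`. -/
def jump (ρ : ℝ) (φ : ℕ × ℕ → ℝ) (x : ℕ × ℕ) : ℝ :=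
  joinRate ρ x.1 x.2 * φ (x.1 + 1, x.2) + joinRate ρ x.2 x.1 * φ (x.1, x.2 + 1) +
  (if x.1 = 0 then 0 else φ (x.1 - 1, x.2)) + (if x.2 = 0 then 0 else φ (x.1, x.2 - 1))

/-- The total rate out of a state. -/
def outRate (ρ : ℝ) (x : ℕ × ℕ) : ℝ :=
  2 * ρ + (if x.1 = 0 then 0 else 1) + (if x.2 = 0 then 0 else 1)

/-- The defect of the balance equation at `y`. -/
def defect (ρ : ℝ) (P : ℕ × ℕ → ℝ) (y : ℕ × ℕ) : ℝ := P y * outRate ρ y - inflow ρ P y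

/-- The negative of the generator of the process, applied to `φ`. -/
def negGen (ρ : ℝ) (φ : ℕ × ℕ → ℝ) (x : ℕ × ℕ) : ℝ := outRate ρ x * φ x - jump ρ φ x

variable {ρ : ℝ}

theorem joinRate_nonneg (hρ : 0 ≤ ρ) (a b : ℕ) : 0 ≤ joinRate ρ a b := by
  unfold joinRate; split_ifs <;> positivity

theorem joinRate_le (hρ : 0 ≤ ρ) (a b : ℕ) : joinRate ρ a b ≤ 2 * ρ := by
  unfold joinRate; split_ifs <;> linarith

theorem joinRate_add (ρ : ℝ) (a b : ℕ) : joinRate ρ a b + joinRate ρ b a = 2 * ρ := by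
  unfold joinRate
  rcases lt_trichotomy a b with h | h | h
  · simp [h, h.not_gt, h.ne']
  · simp [h]; ring
  · simp [h, h.not_gt, h.ne']

theorem rateX_nonneg (hρ : 0 ≤ ρ) (x y : ℕ × ℕ) : 0 ≤ rateX ρ x y := by
  have h1 := joinRate_nonneg hρ x.1 x.2
  have h2 := joinRate_nonneg hρ x.2 x.1
  unfold rateX
  refine add_nonneg (add_nonneg (add_nonneg ?_ ?_) ?_) ?_ <;> split_ifs <;>
    first | assumption | positivity

theorem hasSum_mul_rateX (ρ : ℝ) (P : ℕ × ℕ → ℝ) (y : ℕ × ℕ) :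
    HasSum (fun x => P x * rateX ρ x y) (inflow ρ P y) := by
  have h1 := hasSum_ite_eq_succ_fst (fun x => P x * joinRate ρ x.1 x.2) y
  have h2 := hasSum_ite_eq_succ_snd (fun x => P x * joinRate ρ x.2 x.1) y
  have h3 := hasSum_ite_eq_right P (y.1 + 1, y.2)
  have h4 := hasSum_ite_eq_right P (y.1, y.2 + 1)
  convert ((h1.add h2).add h3).add h4 using 1
  · ext x
    simp only [rateX, mul_add, mul_ite, mul_zero, mul_one]
  · rfl

theorem hasSum_rateX_mul (ρ : ℝ) (φ : ℕ × ℕ → ℝ) (x : ℕ × ℕ) :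
    HasSum (fun y => rateX ρ x y * φ y) (jump ρ φ x) := by
  have h1 := hasSum_ite_eq_right (fun y => joinRate ρ x.1 x.2 * φ y) (x.1 + 1, x.2)
  have h2 := hasSum_ite_eq_right (fun y => joinRate ρ x.2 x.1 * φ y) (x.1, x.2 + 1)
  have h3 := hasSum_ite_eq_succ_fst φ x
  have h4 := hasSum_ite_eq_succ_snd φ x
  convert ((h1.add h2).add h3).add h4 using 1
  · ext y
    simp only [rateX, add_mul, ite_mul, zero_mul, one_mul]
  · rfl

theorem hasSum_rateX (ρ : ℝ) (x : ℕ × ℕ) : HasSum (rateX ρ x) (outRate ρ x) := by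
  have := hasSum_rateX_mul ρ (fun _ => 1) x
  simpa [jump, outRate, joinRate_add] using this

theorem outRate_le (ρ : ℝ) (x : ℕ × ℕ) : outRate ρ x ≤ 2 * ρ + 2 := by
  unfold outRate; split_ifs <;> linarith

theorem satisfiesBalance_rateX_iff {P : ℕ × ℕ → ℝ} :
    SatisfiesBalance (rateX ρ) P ↔ ∀ y, defect ρ P y = 0 := by
  refine forall_congr' fun y => ?_
  rw [(hasSum_rateX ρ y).tsum_eq, defect, sub_eq_zero]
  constructor
  · intro h
    exact h.unique (hasSum_mul_rateX ρ P y)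
  · intro h
    rw [h]
    exact hasSum_mul_rateX ρ P y

/-- At a zero of a nonnegative solution the inflow is zero, so zeros spread backwards along jumps.
Backwards along departures they spread to all larger states. Backwards along the arrivals `(k, k) →
(k, k+1) → (k+1, k+1)` they descend the diagonal to the origin, from which every state is reached.
-/
theorem eq_zero_of_balance_rateX (hρ : 0 < ρ) {P : ℕ × ℕ → ℝ} (hP : ∀ x, 0 ≤ P x)
    (h : SatisfiesBalance (rateX ρ) P) (x : ℕ × ℕ) (hx : P x = 0) (y : ℕ × ℕ) : P y = 0 := by
  have key : ∀ {a b}, P b = 0 → 0 < rateX ρ a b → P a = 0 := by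
    intro a b hb hab
    have h1 := h b
    rw [hb, zero_mul, hasSum_zero_iff_of_nonneg
      (fun x => mul_nonneg (hP x) (rateX_nonneg hρ.le x b))] at h1
    have := congrFun h1 a
    simp only [Pi.zero_apply, mul_eq_zero] at this
    exact this.resolve_right hab.ne'
  have up1 : ∀ i j, P (i, j) = 0 → P (i + 1, j) = 0 := fun i j hij =>
    key hij (by simp [rateX, show ∀ k : ℕ, k ≠ k + 1 + 1 by omega])
  have up2 : ∀ i j, P (i, j) = 0 → P (i, j + 1) = 0 := fun i j hij =>
    key hij (by simp [rateX, show ∀ k : ℕ, k ≠ k + 1 + 1 by omega])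
  have up : ∀ i j k l, P (i, j) = 0 → P (i + k, j + l) = 0 := by
    intro i j k l hij
    have : P (i + k, j) = 0 := by
      induction k with
      | zero => exact hij
      | succ k ih => exact up1 _ _ ih
    induction l with
    | zero => exact this
    | succ l ih => exact up2 _ _ ih
  have down : ∀ k, P (k, k) = 0 → P (0, 0) = 0 := by
    intro k
    induction k with
    | zero => exact id
    | succ k ih =>
      intro hk
      have h1 : P (k, k + 1) = 0 := key hk (by simpa [rateX, joinRate, show ∀ k : ℕ, k ≠ k + 1 + 1 by omega])
      exact ih (key h1 (by simpa [rateX, joinRate, show ∀ k : ℕ, k ≠ k + 1 + 1 by omega]))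
  have h0 : P (0, 0) = 0 := by
    -- Adding the swapped coordinates to `x` leads to a diagonal state.
    refine down (x.1 + x.2) ?_
    have := up x.1 x.2 x.2 x.1 hx
    rwa [add_comm x.2 x.1] at this
  simpa using up 0 0 y.1 y.2 h0

theorem hasSum_of_hasSum_parts {g : ℕ × ℕ → ℝ} {a b c : ℝ} (h0 : HasSum (fun m => g (m, m)) a)
    (h1 : HasSum (fun t : ℕ × ℕ => g (t.1, t.1 + t.2 + 1)) b)
    (h2 : HasSum (fun t : ℕ × ℕ => g (t.1 + t.2 + 1, t.1)) c) : HasSum g (a + b + c) := by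
  have h0' : HasSum (fun x : ℕ × ℕ => if x.1 = x.2 then g x else 0) a := by
    have hi : Function.Injective (fun m : ℕ => ((m, m) : ℕ × ℕ)) := fun m n h => by simp_all
    rw [← hi.hasSum_iff]
    · simpa [Function.comp_def] using h0
    · rintro ⟨i, j⟩ hx
      rw [if_neg]
      rintro (rfl : i = j)
      exact hx ⟨i, rfl⟩
  have h1' : HasSum (fun x : ℕ × ℕ => if x.1 < x.2 then g x else 0) b := by
    have hi : Function.Injective (fun t : ℕ × ℕ => ((t.1, t.1 + t.2 + 1) : ℕ × ℕ)) := by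
      rintro ⟨i, j⟩ ⟨k, l⟩ h
      simp only [Prod.mk.injEq] at h ⊢
      omega
    rw [← hi.hasSum_iff]
    · convert h1 using 2 with t
      exact if_pos (by simp only; omega)
    · rintro ⟨i, j⟩ hx
      rw [if_neg]
      intro (h : i < j)
      exact hx ⟨(i, j - i - 1), by simp only [Prod.mk.injEq, true_and]; omega⟩
  have h2' : HasSum (fun x : ℕ × ℕ => if x.2 < x.1 then g x else 0) c := by
    have hi : Function.Injective (fun t : ℕ × ℕ => ((t.1 + t.2 + 1, t.1) : ℕ × ℕ)) := by
      rintro ⟨i, j⟩ ⟨k, l⟩ h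
      simp only [Prod.mk.injEq] at h ⊢
      omega
    rw [← hi.hasSum_iff]
    · convert h2 using 2 with t
      exact if_pos (by simp only; omega)
    · rintro ⟨i, j⟩ hx
      rw [if_neg]
      intro (h : j < i)
      exact hx ⟨(j, i - j - 1), by simp only [Prod.mk.injEq, and_true]; omega⟩
  convert (h0'.add h1').add h2' using 1
  ext x
  rcases lt_trichotomy x.1 x.2 with h | h | h
  · simp [h, h.not_gt, h.ne]
  · simp [h]
  · simp [h, h.not_gt, h.ne']

/-! ### Functions of the minimum and the absolute difference of the queue lengths -/

/-- The function `p` of `(min x₁ x₂, |x₂ - x₁|)` as a function of `(x₁, x₂)`. -/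
def fold (p : ℕ → ℕ → ℝ) (x : ℕ × ℕ) : ℝ := p (min x.1 x.2) ((x.1 - x.2) + (x.2 - x.1))

@[simp] theorem fold_diag (p : ℕ → ℕ → ℝ) (m : ℕ) : fold p (m, m) = p m 0 := by simp [fold]

theorem fold_lt (p : ℕ → ℕ → ℝ) (m n : ℕ) : fold p (m, m + n) = p m n := by
  simp [fold]

theorem fold_gt (p : ℕ → ℕ → ℝ) (m n : ℕ) : fold p (m + n, m) = p m n := by
  simp [fold]

theorem fold_swap (p : ℕ → ℕ → ℝ) (i j : ℕ) : fold p (j, i) = fold p (i, j) := by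
  simp [fold, min_comm, add_comm]

theorem summable_fold {p : ℕ → ℕ → ℝ} (h0 : Summable fun m => p m 0)
    (h1 : Summable fun t : ℕ × ℕ => p t.1 (t.2 + 1)) : Summable (fold p) := by
  refine (hasSum_of_hasSum_parts (a := ∑' m, p m 0) (b := ∑' t : ℕ × ℕ, p t.1 (t.2 + 1))
    (c := ∑' t : ℕ × ℕ, p t.1 (t.2 + 1)) ?_ ?_ ?_).summable
  · simpa using h0.hasSum
  · convert h1.hasSum using 2 with t
    rw [add_assoc, fold_lt]
  · convert h1.hasSum using 2 with t
    rw [add_assoc, fold_gt]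

theorem exists_eq_lt_or_gt_or_diag (x : ℕ × ℕ) :
    ∃ m n, x = (m, m) ∨ x = (m, m + (n + 1)) ∨ x = (m + (n + 1), m) := by
  obtain ⟨i, j⟩ := x
  rcases lt_trichotomy i j with h | h | h
  · exact ⟨i, j - i - 1, Or.inr (Or.inl (by simp only [Prod.mk.injEq, true_and]; omega))⟩
  · exact ⟨i, 0, Or.inl (by rw [h])⟩
  · exact ⟨j, i - j - 1, Or.inr (Or.inr (by simp only [Prod.mk.injEq, and_true]; omega))⟩

theorem joinRate_lt (ρ : ℝ) (m n : ℕ) : joinRate ρ m (m + (n + 1)) = 2 * ρ := by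
  simp [joinRate]

theorem outRate_swap (ρ : ℝ) (i j : ℕ) : outRate ρ (j, i) = outRate ρ (i, j) := by
  simp only [outRate]; ring

theorem defect_fold_swap (ρ : ℝ) (p : ℕ → ℕ → ℝ) (i j : ℕ) :
    defect ρ (fold p) (j, i) = defect ρ (fold p) (i, j) := by
  simp only [defect, inflow, outRate_swap ρ i j, fold_swap p _ i, fold_swap p _ (i + 1),
    fold_swap p _ (i - 1)]
  ring

theorem negGen_fold_swap (ρ : ℝ) (p : ℕ → ℕ → ℝ) (i j : ℕ) :
    negGen ρ (fold p) (j, i) = negGen ρ (fold p) (i, j) := by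
  simp only [negGen, jump, outRate_swap ρ i j, fold_swap p _ i, fold_swap p _ (i + 1),
    fold_swap p _ (i - 1)]
  ring

/-! ### Defect and generator in the coordinates `(m, n)` -/

theorem defect_fold_diag (ρ : ℝ) (p : ℕ → ℕ → ℝ) (m : ℕ) : defect ρ (fold p) (m, m) =
    2 * (ρ * p m 0 - p m 1 + if m = 0 then 0 else p m 0 - 2 * ρ * p (m - 1) 1) := by
  cases m with
  | zero => simp [defect, inflow, outRate, fold]; ring
  | succ m => simp [defect, inflow, outRate, fold, joinRate]; ring

/-- The difference is `n + 1`, so `n = 0` is the row next to the diagonal. The four cases given by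
`m = 0` or not and `n = 0` or not become (O), (V), (H) and (I) once the values `p m 0` are
eliminated. -/
theorem defect_fold_lt (ρ : ℝ) (p : ℕ → ℕ → ℝ) (m n : ℕ) :
    defect ρ (fold p) (m, m + (n + 1)) =
      (1 + 2 * ρ) * p m (n + 1) - p m (n + 2) - p (m + 1) n - (if n = 0 then ρ * p m 0 else 0)
      + if m = 0 then 0 else p m (n + 1) - 2 * ρ * p (m - 1) (n + 2) := by
  have e0 := fold_lt p m (n + 1)
  have e1 := fold_lt p m n
  have e2 := fold_lt p m (n + 2)
  have e3 := fold_lt p (m + 1) n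
  -- An arrival increases the difference only from a tie, and then at rate `ρ` per queue.
  have j2 : p m n * joinRate ρ (m + n) m = if n = 0 then ρ * p m 0 else 0 := by
    cases n <;> simp [joinRate, mul_comm]
  rw [show m + 1 + n = m + (n + 1) by ring] at e3
  simp only [defect, inflow, outRate]
  cases m with
  | zero =>
    simp only [zero_add] at *
    simp [e0, e1, e2, e3, j2]
    ring
  | succ m =>
    have e4 := fold_lt p m (n + 2)
    have j1 := joinRate_lt ρ m (n + 1)
    rw [show m + (n + 2) = m + 1 + (n + 1) by ring] at e4
    rw [show m + (n + 1 + 1) = m + 1 + (n + 1) by ring] at j1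
    simp only [show m + 1 + (n + 1) - 1 = m + 1 + n by omega, Nat.add_sub_cancel, e0, e1, e3, e4,
      j1, j2, show m + 1 + (n + 1) + 1 = m + 1 + (n + 2) by ring, e2]
    simp
    ring

theorem negGen_fold_diag (ρ : ℝ) (p : ℕ → ℕ → ℝ) (m : ℕ) : negGen ρ (fold p) (m, m) =
    2 * (ρ * (p m 0 - p m 1) + if m = 0 then 0 else p m 0 - p (m - 1) 1) := by
  cases m with
  | zero => simp [negGen, jump, outRate, fold, joinRate]; ring
  | succ m => simp [negGen, jump, outRate, fold, joinRate]; ring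

theorem negGen_fold_lt (ρ : ℝ) (p : ℕ → ℕ → ℝ) (m n : ℕ) :
    negGen ρ (fold p) (m, m + (n + 1)) =
      2 * ρ * (p m (n + 1) - p (m + 1) n) + (p m (n + 1) - p m n)
      + if m = 0 then 0 else p m (n + 1) - p (m - 1) (n + 2) := by
  have e0 := fold_lt p m (n + 1)
  have e1 := fold_lt p m n
  have e3 := fold_lt p (m + 1) n
  have j1 := joinRate_lt ρ m n
  have j2 : joinRate ρ (m + (n + 1)) m = 0 := by simp [joinRate]
  rw [show m + 1 + n = m + (n + 1) by ring] at e3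
  simp only [negGen, jump, outRate]
  cases m with
  | zero =>
    simp only [zero_add] at *
    simp [e0, e1, e3, j1, j2]
    ring
  | succ m =>
    have e4 := fold_lt p m (n + 2)
    rw [show m + (n + 2) = m + 1 + (n + 1) by ring] at e4
    simp only [show m + 1 + (n + 1) - 1 = m + 1 + n by omega, Nat.add_sub_cancel, e0, e1, e3, e4,
      j1, j2]
    simp
    ring

/-- Summation by parts: the defect of a weight tested against a function of at most
exponential growth. -/
theorem tsum_defect_mul_fold (hρ : 0 < ρ) {y z K : ℝ} (hy : 1 ≤ y) (hz : 1 ≤ z)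
    {P : ℕ × ℕ → ℝ} {φ : ℕ → ℕ → ℝ} (hφ : ∀ m n, |φ m n| ≤ K * (y ^ m * z ^ n))
    (hP : Summable fun x => |P x| * fold (fun m n => y ^ m * z ^ n) x) :
    ∑' x, defect ρ P x * fold φ x = ∑' x, P x * negGen ρ (fold φ) x := by
  set Φ : ℕ → ℕ → ℝ := fun m n => y ^ m * z ^ n with hΦ
  have hΦ0 : ∀ x, 0 ≤ fold Φ x := fun x => by
    simp only [fold, hΦ]; positivity
  have hK : 0 ≤ K := by
    have := (abs_nonneg _).trans (hφ 0 0)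
    simpa using this
  have hφx : ∀ x, |fold φ x| ≤ K * fold Φ x := fun x => hφ _ _
  -- A jump raises the minimum and the absolute difference by at most one each, so the weight grows
  -- by at most the factor `y * z`.
  have step : ∀ m n m' n' : ℕ, m' ≤ m + 1 → n' ≤ n + 1 → Φ m' n' ≤ y * z * Φ m n := by
    intro m n m' n' hm hn
    calc y ^ m' * z ^ n' ≤ y ^ (m + 1) * z ^ (n + 1) := by gcongr
      _ = y * z * (y ^ m * z ^ n) := by ring
  have s1 : ∀ i j, fold Φ (i + 1, j) ≤ y * z * fold Φ (i, j) := fun i j =>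
    step _ _ _ _ (by simp only; omega) (by simp only; omega)
  have s2 : ∀ i j, fold Φ (i, j + 1) ≤ y * z * fold Φ (i, j) := fun i j =>
    step _ _ _ _ (by simp only; omega) (by simp only; omega)
  have s3 : ∀ i j, fold Φ (i - 1, j) ≤ y * z * fold Φ (i, j) := fun i j =>
    step _ _ _ _ (by simp only; omega) (by simp only; omega)
  have s4 : ∀ i j, fold Φ (i, j - 1) ≤ y * z * fold Φ (i, j) := fun i j =>
    step _ _ _ _ (by simp only; omega) (by simp only; omega)
  -- In `4 * ρ + 2`, each of the two arrival rates is bounded by `2 * ρ` and each of the two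
  -- departure rates by 1.
  have hb : ∀ x, jump ρ (fun x => |fold φ x|) x ≤ ((4 * ρ + 2) * (K * (y * z))) * fold Φ x := by
    rintro ⟨i, j⟩
    have hnn : 0 ≤ K * (y * z * fold Φ (i, j)) := by
      have := hΦ0 (i, j); positivity
    have b1 := (hφx (i + 1, j)).trans (mul_le_mul_of_nonneg_left (s1 i j) hK)
    have b2 := (hφx (i, j + 1)).trans (mul_le_mul_of_nonneg_left (s2 i j) hK)
    have b3 := (hφx (i - 1, j)).trans (mul_le_mul_of_nonneg_left (s3 i j) hK)
    have b4 := (hφx (i, j - 1)).trans (mul_le_mul_of_nonneg_left (s4 i j) hK)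
    have c1 := mul_le_mul (joinRate_le hρ.le i j) b1 (abs_nonneg _) (by positivity)
    have c2 := mul_le_mul (joinRate_le hρ.le j i) b2 (abs_nonneg _) (by positivity)
    have c3 : (if i = 0 then 0 else |fold φ (i - 1, j)|) ≤ K * (y * z * fold Φ (i, j)) := by
      split_ifs <;> assumption
    have c4 : (if j = 0 then 0 else |fold φ (i, j - 1)|) ≤ K * (y * z * fold Φ (i, j)) := by
      split_ifs <;> assumption
    simp only [jump]
    linarith
  obtain ⟨f1, f2, f3⟩ := tsum_inflow_mul_eq (q := rateX ρ) (p := P) (φ := fold φ) (Φ := fold Φ)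
    (rateX_nonneg hρ.le) (fun x => (hasSum_rateX_mul ρ (fun x => |fold φ x|) x).summable)
    (fun x => by rw [(hasSum_rateX_mul ρ (fun x => |fold φ x|) x).tsum_eq]; exact hb x) hP
  simp only [(hasSum_rateX_mul ρ _ _).tsum_eq, (hasSum_mul_rateX ρ _ _).tsum_eq] at f1 f2 f3
  have f0 : Summable fun x => P x * outRate ρ x * fold φ x := by
    refine Summable.of_norm_bounded (hP.mul_left ((2 * ρ + 2) * K)) fun x => ?_
    have h1 : 0 ≤ outRate ρ x := by unfold outRate; split_ifs <;> positivity
    rw [Real.norm_eq_abs, abs_mul, abs_mul, abs_of_nonneg h1]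
    calc |P x| * outRate ρ x * |fold φ x| ≤ |P x| * (2 * ρ + 2) * (K * fold Φ x) := by
          gcongr
          · exact outRate_le ρ x
          · exact hφx x
      _ = _ := by ring
  have e1 : (fun x => defect ρ P x * fold φ x) =
      fun x => P x * outRate ρ x * fold φ x - inflow ρ P x * fold φ x := by
    ext x; rw [defect]; ring
  have e2 : (fun x => P x * negGen ρ (fold φ) x) =
      fun x => P x * outRate ρ x * fold φ x - P x * jump ρ (fold φ) x := by
    ext x; rw [negGen]; ring
  rw [e1, e2, f0.tsum_sub f1, f0.tsum_sub f2, f3]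

end

end JSQ

namespace JSQ

noncomputable section

/-! ### The roots of the interior equation -/

/-- The smaller root of `x ^ 2 - (2 (1 + ρ) - β) x + 2 ρ`, the ratio `α / β` of a vertical step. -/
def ratioSmall (ρ β : ℝ) : ℝ :=
  ((2 * (1 + ρ) - β) - √((2 * (1 + ρ) - β) ^ 2 - 8 * ρ)) / 2

/-- The larger root of `u ^ 2 - 2 (1 + ρ) u + 2 ρ + α`, the ratio `α / β` of a horizontal step. -/
def ratioLarge (ρ α : ℝ) : ℝ := 1 + ρ + √(1 + ρ ^ 2 - α)

variable {ρ α β : ℝ}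

/-- The quadratic is `2ρ > 0` at 0 and `β - 1 < 0` at 1, so its smaller root lies strictly between.
-/
theorem ratioSmall_spec (hρ : 0 < ρ) (hβ₁ : β < 1) :
    ratioSmall ρ β ^ 2 - (2 * (1 + ρ) - β) * ratioSmall ρ β + 2 * ρ = 0 ∧
      0 < ratioSmall ρ β ∧ ratioSmall ρ β < 1 := by
  set b := 2 * (1 + ρ) - β with hb
  have hb1 : 1 + 2 * ρ < b := by rw [hb]; linarith
  -- From `b > 1 + 2ρ` the discriminant exceeds `(1 + 2ρ)² - 8ρ = (1 - 2ρ)²`.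
  have hD : 0 ≤ b ^ 2 - 8 * ρ := by nlinarith [sq_nonneg (1 - 2 * ρ)]
  have hs := Real.sq_sqrt hD
  have hs0 := Real.sqrt_nonneg (b ^ 2 - 8 * ρ)
  have hx : ratioSmall ρ β = (b - √(b ^ 2 - 8 * ρ)) / 2 := rfl
  rw [hx]
  refine ⟨by linear_combination (1 / 4) * hs, ?_, ?_⟩
  · have : √(b ^ 2 - 8 * ρ) < b := by
      rw [Real.sqrt_lt' (by linarith)]; linarith
    linarith
  · have : b - 2 < √(b ^ 2 - 8 * ρ) := by
      apply Real.lt_sqrt_of_sq_lt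
      nlinarith
    linarith

theorem ratioLarge_spec (hα : α < 1) :
    ratioLarge ρ α ^ 2 - 2 * (1 + ρ) * ratioLarge ρ α + 2 * ρ + α = 0 ∧
      1 + ρ < ratioLarge ρ α := by
  have hD : 0 < 1 + ρ ^ 2 - α := by nlinarith [sq_nonneg ρ]
  have hs := Real.sq_sqrt hD.le
  have hs0 := Real.sqrt_pos.2 hD
  unfold ratioLarge
  exact ⟨by linear_combination hs, by linarith⟩

theorem interiorCurve_ofReal : InteriorCurve (ρ : ℂ) (α : ℂ) (β : ℂ) ↔ InteriorCurve ρ α β := by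
  unfold InteriorCurve
  norm_cast

/-- The ratios `z / β` are the roots of the quadratic of `ratioSmall`. Both are real and they lie on
either side of 1, so only the smaller one gives `‖z‖ < β`. -/
theorem interiorCurve_alpha_iff (hρ : 0 < ρ) (hβ : 0 < β) (hβ₁ : β < 1) (z : ℂ) :
    (InteriorCurve (ρ : ℂ) z (β : ℂ) ∧ ‖z‖ < β) ↔ z = ((β * ratioSmall ρ β : ℝ) : ℂ) := by
  obtain ⟨h1, h2, h3⟩ := ratioSmall_spec hρ hβ₁
  set x := ratioSmall ρ β
  constructor
  · rintro ⟨hz, hn⟩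
    unfold InteriorCurve at hz
    have h1' : (x : ℂ) ^ 2 - (2 * (1 + ρ) - β) * x + 2 * ρ = 0 := by exact_mod_cast h1
    -- The product of the two ratios is `2ρ`, so the second root is `2ρβ / x`.
    have hf : (z - ((β * x : ℝ) : ℂ)) * (x * z - ((2 * ρ * β : ℝ) : ℂ)) = 0 := by
      push_cast
      linear_combination x * hz - β * z * h1'
    rcases mul_eq_zero.1 hf with h | h
    · exact sub_eq_zero.1 h
    · exfalso
      have h4 : x * ‖z‖ = 2 * ρ * β := by
        have := congrArg norm (sub_eq_zero.1 h)
        rw [norm_mul, Complex.norm_real, Complex.norm_real, Real.norm_of_nonneg h2.le,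
          Real.norm_of_nonneg (by positivity)] at this
        exact this
      -- The quadratic gives `(x - 1)(x - 2ρ) = (1 - β) x > 0`, and `x < 1`.
      have h5 : x < 2 * ρ := by nlinarith
      nlinarith
  · rintro rfl
    refine ⟨interiorCurve_ofReal.2 ?_, ?_⟩
    · unfold InteriorCurve
      linear_combination β ^ 2 * h1
    · rw [Complex.norm_real, Real.norm_of_nonneg (by positivity)]
      nlinarith

/-- The ratios `α / z` are the roots of the quadratic of `ratioLarge`, whose value at 1 is `α - 1 <
0`. They lie on either side of 1, and only the larger one gives `‖z‖ < α`. The other ratio is `2(1 +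
ρ) - u`. -/
theorem interiorCurve_beta_iff (hρ : 0 < ρ) (hα : 0 < α) (hα₁ : α < 1) (z : ℂ) :
    (InteriorCurve (ρ : ℂ) (α : ℂ) z ∧ ‖z‖ < α) ↔ z = ((α / ratioLarge ρ α : ℝ) : ℂ) := by
  obtain ⟨h1, h2⟩ := ratioLarge_spec (ρ := ρ) hα₁
  set u := ratioLarge ρ α
  have hu : 0 < u := by linarith
  constructor
  · rintro ⟨hz, hn⟩
    unfold InteriorCurve at hz
    have h1' : (u : ℂ) ^ 2 - 2 * (1 + ρ) * u + 2 * ρ + α = 0 := by exact_mod_cast h1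
    have hf : ((u : ℂ) * z - α) * (((2 * (1 + ρ) - u : ℝ) : ℂ) * z - α) = 0 := by
      push_cast
      linear_combination hz - z ^ 2 * h1'
    rcases mul_eq_zero.1 hf with h | h
    · have hu' : (u : ℂ) ≠ 0 := by exact_mod_cast hu.ne'
      push_cast
      rw [eq_div_iff hu', mul_comm]
      exact sub_eq_zero.1 h
    · exfalso
      have h0 : 0 < 2 * (1 + ρ) - u := by
        by_contra hc
        nlinarith [mul_nonneg hu.le (by linarith : 0 ≤ u - 2 * (1 + ρ))]
      have h4 : (2 * (1 + ρ) - u) * ‖z‖ = α := by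
        have := congrArg norm (sub_eq_zero.1 h)
        rw [norm_mul, Complex.norm_real, Complex.norm_real, Real.norm_of_nonneg h0.le,
          Real.norm_of_nonneg hα.le] at this
        exact this
      have h5 : 2 * (1 + ρ) - u < 1 := by nlinarith
      nlinarith [norm_nonneg z]
  · rintro rfl
    refine ⟨interiorCurve_ofReal.2 ?_, ?_⟩
    · unfold InteriorCurve
      field_simp
      linear_combination α ^ 2 * h1
    · rw [Complex.norm_real, Real.norm_of_nonneg (by positivity), div_lt_iff₀ hu]
      nlinarith

theorem interiorCurve_alpha_real_iff (hρ : 0 < ρ) (hβ : 0 < β) (hβ₁ : β < 1) (a : ℝ) :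
    (InteriorCurve ρ a β ∧ |a| < |β|) ↔ a = β * ratioSmall ρ β := by
  have := interiorCurve_alpha_iff hρ hβ hβ₁ (a : ℂ)
  rw [abs_of_pos hβ]
  rwa [interiorCurve_ofReal, Complex.norm_real, Real.norm_eq_abs, Complex.ofReal_inj] at this

theorem interiorCurve_beta_real_iff (hρ : 0 < ρ) (hα : 0 < α) (hα₁ : α < 1) (b : ℝ) :
    (InteriorCurve ρ α b ∧ |b| < |α|) ↔ b = α / ratioLarge ρ α := by
  have := interiorCurve_beta_iff hρ hα hα₁ (b : ℂ)
  rw [abs_of_pos hα]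
  rwa [interiorCurve_ofReal, Complex.norm_real, Real.norm_eq_abs, Complex.ofReal_inj] at this

/-- The expression vanishes on the line `α = (1 + ρ)β - ρ`. This line meets the curve only at `β =
1`, `β = ρ` and `β = -ρ/(1 + ρ)`; the first two give `α = 1` and `α = ρ²`. -/
theorem InteriorCurve.horizontal_ne (hρ : 0 < ρ) (hβ : 0 < β) (hα₁ : α ≠ 1) (hα : α ≠ ρ ^ 2)
    (h : InteriorCurve ρ α β) : (ρ + α) / β - (1 + ρ) ≠ 0 := by
  intro h0
  have h1 : α = (1 + ρ) * β - ρ := by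
    field_simp at h0
    linarith
  have h2 : (β - 1) * ((β - ρ) * ((1 + ρ) * β + ρ)) = 0 := by
    unfold InteriorCurve at h
    rw [h1] at h
    linear_combination h
  rcases mul_eq_zero.1 h2 with h3 | h3
  · exact hα₁ (by rw [h1, sub_eq_zero.1 h3]; ring)
  · rcases mul_eq_zero.1 h3 with h4 | h4
    · exact hα (by rw [h1, sub_eq_zero.1 h4]; ring)
    · have : 0 < (1 + ρ) * β + ρ := by positivity
      linarith

/-- Two distinct roots `α`, `α'` for the same `β`. -/
theorem InteriorCurve.alpha_add {α' : ℝ} (h : InteriorCurve ρ α β) (h' : InteriorCurve ρ α' β)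
    (hne : α ≠ α') : α + α' = 2 * (1 + ρ) * β - β ^ 2 := by
  have : (α - α') * (α + α' - (2 * (1 + ρ) * β - β ^ 2)) = 0 := by
    unfold InteriorCurve at h h'
    linear_combination h - h'
  exact sub_eq_zero.1 ((mul_eq_zero.1 this).resolve_left (sub_ne_zero.2 hne))

/-- Two distinct roots `β`, `β'` for the same `α`. -/
theorem InteriorCurve.beta_mul {β' : ℝ} (h : InteriorCurve ρ α β) (h' : InteriorCurve ρ α β')
    (hne : β ≠ β') : (2 * ρ + α) * (β * β') = α ^ 2 := by
  have : (β - β') * ((2 * ρ + α) * (β * β') - α ^ 2) = 0 := by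
    unfold InteriorCurve at h h'
    linear_combination β' * h - β * h'
  exact sub_eq_zero.1 ((mul_eq_zero.1 this).resolve_left (sub_ne_zero.2 hne))

/-! ### Product forms and the balance equations -/

theorem InteriorBalance.add {f g : ℕ → ℕ → ℝ} (hf : InteriorBalance ρ f)
    (hg : InteriorBalance ρ g) : InteriorBalance ρ (fun m n => f m n + g m n) := by
  intro m n hm hn
  linear_combination hf m n hm hn + hg m n hm hn

theorem InteriorCurve.interiorBalance (h : InteriorCurve ρ α β) (c : ℝ) :
    InteriorBalance ρ (fun m n => c * α ^ m * β ^ n) := by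
  intro m n hm hn
  obtain ⟨k, rfl⟩ := Nat.exists_eq_add_of_le' hm
  obtain ⟨l, rfl⟩ := Nat.exists_eq_add_of_le' hn
  unfold InteriorCurve at h
  simp only [Nat.add_sub_cancel, show l + 2 - 1 = l + 1 by omega]
  linear_combination (-c * α ^ k * β ^ (l + 1)) * h

/-- The defect of a product form in the horizontal boundary equations. -/
theorem InteriorCurve.horizontal_defect (hρ : 0 < ρ) (h : InteriorCurve ρ α β) (c : ℝ) (k : ℕ) :
    2 * (1 + ρ) * (c * α ^ (k + 1) * β ^ 1) - (2 * ρ * (c * α ^ k * β ^ 2)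
      + c * α ^ (k + 1) * β ^ 2
      + ρ / (1 + ρ) * (2 * ρ * (c * α ^ k * β ^ 1) + c * α ^ (k + 1) * β ^ 1)
      + 1 / (1 + ρ) * (2 * ρ * (c * α ^ (k + 1) * β ^ 1) + c * α ^ (k + 2) * β ^ 1)) =
    α ^ k / (1 + ρ) * (c * (α ^ 2 * (1 + ρ) - β * (α + ρ) * (α + 2 * ρ))) := by
  unfold InteriorCurve at h
  have h1 : (1 + ρ) ≠ 0 := by positivity
  field_simp
  linear_combination (-c * α ^ k * (1 + ρ)) * h

theorem horizontalBalance_single (hρ : 0 < ρ) (h : InteriorCurve ρ α β) (c : ℝ)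
    (h0 : α ^ 2 * (1 + ρ) - β * (α + ρ) * (α + 2 * ρ) = 0) :
    HorizontalBalance ρ (fun m n => c * α ^ m * β ^ n) := by
  intro m hm
  obtain ⟨k, rfl⟩ := Nat.exists_eq_add_of_le' hm
  have := h.horizontal_defect hρ c k
  rw [h0, mul_zero, mul_zero] at this
  simp only [Nat.add_sub_cancel]
  linear_combination this

/-- With `α` in common, both defects carry the factor `α ^ k`. By Vieta, `α² = (2ρ + α)ββ'`, which
turns the defect of the `β` term into a multiple of `c * ((ρ + α)/β' - (1 + ρ))` and symmetrically
for `β'`, with the same multiplier. Cancellation determines `c'`. -/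
theorem horizontalBalance_pair {β' c c' : ℝ} (hρ : 0 < ρ) (h : InteriorCurve ρ α β)
    (h' : InteriorCurve ρ α β') (hβ : β ≠ 0) (hβ' : β' ≠ 0) (hne : β ≠ β')
    (hd : (ρ + α) / β - (1 + ρ) ≠ 0)
    (hc : c' = -(((ρ + α) / β' - (1 + ρ)) / ((ρ + α) / β - (1 + ρ))) * c) :
    HorizontalBalance ρ (fun m n => c * α ^ m * β ^ n + c' * α ^ m * β' ^ n) := by
  intro m hm
  obtain ⟨k, rfl⟩ := Nat.exists_eq_add_of_le' hm
  have e1 := h.horizontal_defect hρ c k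
  have e2 := h'.horizontal_defect hρ c' k
  have h2 := h.beta_mul h' hne
  have h3 : c' * ((ρ + α) / β - (1 + ρ)) + c * ((ρ + α) / β' - (1 + ρ)) = 0 := by
    rw [hc]
    linear_combination (-c) * div_mul_cancel₀ ((ρ + α) / β' - (1 + ρ)) hd
  have h4 : c' * β' * (ρ + α - (1 + ρ) * β) + c * β * (ρ + α - (1 + ρ) * β') = 0 := by
    field_simp at h3
    linear_combination h3
  have h5 : c * (α ^ 2 * (1 + ρ) - β * (α + ρ) * (α + 2 * ρ)) +
      c' * (α ^ 2 * (1 + ρ) - β' * (α + ρ) * (α + 2 * ρ)) = 0 := by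
    linear_combination -(2 * ρ + α) * h4 - (1 + ρ) * (c + c') * h2
  simp only [Nat.add_sub_cancel]
  linear_combination e1 + e2 + α ^ k / (1 + ρ) * h5

/-- Since `α + α' = 2(1 + ρ)β - β²`, the defect of `α ^ m * β ^ n` in (V) is `β ^ (n - 1) * (α' -
β)`, and that of its partner is `β ^ (n - 1) * (α - β)`. Cancellation determines `c'`. -/
theorem verticalBalance_pair {α' c c' : ℝ} (h : InteriorCurve ρ α β)
    (h' : InteriorCurve ρ α' β) (hne : α ≠ α') (hd : α - β ≠ 0)
    (hc : c' = -((α' - β) / (α - β)) * c) :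
    VerticalBalance ρ (fun m n => c * α ^ m * β ^ n + c' * α' ^ m * β ^ n) := by
  intro n hn
  obtain ⟨l, rfl⟩ := Nat.exists_eq_add_of_le' hn
  have h2 := h.alpha_add h' hne
  have h3 : c' * (α - β) + c * (α' - β) = 0 := by
    rw [hc]; field_simp; ring
  simp only [show l + 2 - 1 = l + 1 by omega]
  linear_combination β ^ (l + 1) * h3 - (c + c') * β ^ (l + 1) * h2

/-! ### The sequences of the compensation procedure -/

/-- The sequence `α_i` in closed recursive form. -/
def alphaSeq (ρ : ℝ) : ℕ → ℝ
  | 0 => ρ ^ 2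
  | i + 1 => alphaSeq ρ i / ratioLarge ρ (alphaSeq ρ i) *
      ratioSmall ρ (alphaSeq ρ i / ratioLarge ρ (alphaSeq ρ i))

/-- The sequence `β_i` in closed recursive form. -/
def betaSeq (ρ : ℝ) (i : ℕ) : ℝ := alphaSeq ρ i / ratioLarge ρ (alphaSeq ρ i)

/-- The factor `v_i / h_i`. -/
def vFactor (a b : ℕ → ℝ) (i : ℕ) : ℝ := -((a (i + 1) - b i) / (a i - b i))

/-- The factor `h_{i+1} / v_i`. -/
def hFactor (ρ : ℝ) (a b : ℕ → ℝ) (i : ℕ) : ℝ :=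
  -(((ρ + a (i + 1)) / b (i + 1) - (1 + ρ)) / ((ρ + a (i + 1)) / b i - (1 + ρ)))

/-- The sequence `h_i` in closed recursive form. -/
def hSeq (ρ : ℝ) (a b : ℕ → ℝ) : ℕ → ℝ
  | 0 => 1
  | i + 1 => hFactor ρ a b i * (vFactor a b i * hSeq ρ a b i)

/-- The sequences of the compensation procedure. -/
def compParams (ρ : ℝ) : Params where
  α := alphaSeq ρ
  β := betaSeq ρ
  h := hSeq ρ (alphaSeq ρ) (betaSeq ρ)
  v i := vFactor (alphaSeq ρ) (betaSeq ρ) i * hSeq ρ (alphaSeq ρ) (betaSeq ρ) i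

/-- The ratio `α / β` exceeds `1 + ρ`. This is kept in place of `β < α` because it yields the
geometric decay of `α` and `β`. -/
theorem alphaSeq_bounds (hρ : 0 < ρ) (hρ₁ : ρ < 1) (i : ℕ) :
    0 < alphaSeq ρ i ∧ alphaSeq ρ i < 1 ∧ 0 < betaSeq ρ i ∧
      (1 + ρ) * betaSeq ρ i < alphaSeq ρ i := by
  have aux : ∀ a, 0 < a → a < 1 → 0 < a / ratioLarge ρ a ∧ (1 + ρ) * (a / ratioLarge ρ a) < a := by
    intro a ha ha1
    have h := (ratioLarge_spec (ρ := ρ) ha1).2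
    have hu : 0 < ratioLarge ρ a := by linarith
    refine ⟨by positivity, ?_⟩
    rw [← mul_div_assoc, div_lt_iff₀ hu]
    nlinarith
  suffices h : 0 < alphaSeq ρ i ∧ alphaSeq ρ i < 1 from ⟨h.1, h.2, aux _ h.1 h.2⟩
  induction i with
  | zero => exact ⟨by simp only [alphaSeq]; positivity, by simp only [alphaSeq]; nlinarith⟩
  | succ i ih =>
    obtain ⟨h1, h2⟩ := aux _ ih.1 ih.2
    set b := alphaSeq ρ i / ratioLarge ρ (alphaSeq ρ i) with hb
    have hb1 : b < 1 := by nlinarith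
    obtain ⟨-, h3, h4⟩ := ratioSmall_spec hρ hb1
    simp only [alphaSeq, ← hb]
    exact ⟨by positivity, by nlinarith⟩

theorem alphaSeq_succ (ρ : ℝ) (i : ℕ) :
    alphaSeq ρ (i + 1) = betaSeq ρ i * ratioSmall ρ (betaSeq ρ i) := rfl

theorem betaSeq_zero (ρ : ℝ) : betaSeq ρ 0 = ρ ^ 2 / (2 + ρ) := by
  simp only [betaSeq, alphaSeq, ratioLarge]
  norm_num
  ring_nf

theorem isCompensation_compParams (hρ : 0 < ρ) (hρ₁ : ρ < 1) :
    IsCompensation ρ (compParams ρ) where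
  α_zero := rfl
  β_zero := betaSeq_zero ρ
  h_zero := rfl
  α_succ i := by
    obtain ⟨h1, h2, h3, h4⟩ := alphaSeq_bounds hρ hρ₁ i
    exact (interiorCurve_alpha_real_iff hρ h3 (by nlinarith) _).2 (alphaSeq_succ ρ i)
  v_eq i := rfl
  β_succ i := by
    obtain ⟨h1, h2, h3, h4⟩ := alphaSeq_bounds hρ hρ₁ (i + 1)
    exact (interiorCurve_beta_real_iff hρ h1 h2 _).2 rfl
  h_succ i := rfl

theorem IsCompensation.eq_compParams (hρ : 0 < ρ) (hρ₁ : ρ < 1) {P : Params}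
    (hP : IsCompensation ρ P) : P = compParams ρ := by
  have hαβ : ∀ i, P.α i = alphaSeq ρ i ∧ P.β i = betaSeq ρ i := by
    intro i
    induction i with
    | zero => exact ⟨hP.α_zero, hP.β_zero.trans (betaSeq_zero ρ).symm⟩
    | succ i ih =>
      obtain ⟨-, h2, h3, h4⟩ := alphaSeq_bounds hρ hρ₁ i
      have ha := hP.α_succ i
      rw [ih.2] at ha
      have ha' := (interiorCurve_alpha_real_iff hρ h3 (by nlinarith) _).1 ha
      rw [← alphaSeq_succ] at ha'
      obtain ⟨h1, h2, -, -⟩ := alphaSeq_bounds hρ hρ₁ (i + 1)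
      have hb := hP.β_succ i
      rw [ha'] at hb
      exact ⟨ha', (interiorCurve_beta_real_iff hρ h1 h2 _).1 hb⟩
  have hα : P.α = alphaSeq ρ := funext fun i => (hαβ i).1
  have hβ : P.β = betaSeq ρ := funext fun i => (hαβ i).2
  have hv : ∀ i, P.v i = vFactor (alphaSeq ρ) (betaSeq ρ) i * P.h i := fun i => by
    rw [hP.v_eq, hα, hβ, vFactor]
  have hh : P.h = hSeq ρ (alphaSeq ρ) (betaSeq ρ) := by
    funext i
    induction i with
    | zero => exact hP.h_zero
    | succ i ih => rw [hP.h_succ, hv, ih, hα, hβ]; rfl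
  have hv' : P.v = (compParams ρ).v := funext fun i => by rw [hv, hh]; rfl
  cases P
  simp only at hα hβ hh hv'
  subst hα hβ hh hv'
  rfl

/-- The properties of the parameters that the later arguments use. -/
structure Params.Regular (ρ : ℝ) (P : Params) : Prop where
  α_pos : ∀ i, 0 < P.α i
  α_lt_one : ∀ i, P.α i < 1
  β_pos : ∀ i, 0 < P.β i
  β_lt : ∀ i, (1 + ρ) * P.β i < P.α i
  β_eq : ∀ i, P.β i = P.α i / ratioLarge ρ (P.α i)
  α_succ_eq : ∀ i, P.α (i + 1) = P.β i * ratioSmall ρ (P.β i)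
  α_succ_lt : ∀ i, P.α (i + 1) < P.β i
  curve : ∀ i, InteriorCurve ρ (P.α i) (P.β i)
  curve_succ : ∀ i, InteriorCurve ρ (P.α (i + 1)) (P.β i)

theorem IsCompensation.regular (hρ : 0 < ρ) (hρ₁ : ρ < 1) {P : Params}
    (hP : IsCompensation ρ P) : P.Regular ρ := by
  rw [hP.eq_compParams hρ hρ₁]
  have hb := alphaSeq_bounds hρ hρ₁
  have hs : ∀ i, (compParams ρ).α (i + 1) < (compParams ρ).β i := fun i => by
    have h := (isCompensation_compParams hρ hρ₁).α_succ i
    have h1 : 0 < (compParams ρ).β i := (hb i).2.2.1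
    have h2 : 0 < (compParams ρ).α (i + 1) := (hb (i + 1)).1
    rw [abs_of_pos h1, abs_of_pos h2] at h
    exact h.2
  refine ⟨fun i => (hb i).1, fun i => (hb i).2.1, fun i => (hb i).2.2.1, fun i => (hb i).2.2.2,
    fun i => rfl, fun i => rfl, hs, fun i => ?_,
    fun i => ((isCompensation_compParams hρ hρ₁).α_succ i).1⟩
  exact ((interiorCurve_beta_real_iff hρ (hb i).1 (hb i).2.1 _).2 rfl).1

namespace Params.Regular

variable {P : Params}

theorem β_lt_α (R : P.Regular ρ) (hρ : 0 < ρ) (i : ℕ) : P.β i < P.α i := by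
  nlinarith [R.β_lt i, R.β_pos i]

theorem β_lt_one (R : P.Regular ρ) (hρ : 0 < ρ) (i : ℕ) : P.β i < 1 := (R.β_lt_α hρ i).trans (R.α_lt_one i)

theorem α_strictAnti (R : P.Regular ρ) (hρ : 0 < ρ) : StrictAnti P.α :=
  strictAnti_nat_of_succ_lt fun i => (R.α_succ_lt i).trans (R.β_lt_α hρ i)

theorem β_strictAnti (R : P.Regular ρ) (hρ : 0 < ρ) : StrictAnti P.β :=
  strictAnti_nat_of_succ_lt fun i => (R.β_lt_α hρ (i + 1)).trans (R.α_succ_lt i)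

theorem horizontal_ne (R : P.Regular ρ) (hρ : 0 < ρ) (h0 : P.α 0 = ρ ^ 2) (i : ℕ) :
    (ρ + P.α (i + 1)) / P.β i - (1 + ρ) ≠ 0 :=
  (R.curve_succ i).horizontal_ne hρ (R.β_pos i) (R.α_lt_one _).ne
    (by rw [← h0]; exact (R.α_strictAnti hρ (Nat.succ_pos i)).ne)

theorem horizontal_ne_succ (R : P.Regular ρ) (hρ : 0 < ρ) (h0 : P.α 0 = ρ ^ 2) (i : ℕ) :
    (ρ + P.α (i + 1)) / P.β (i + 1) - (1 + ρ) ≠ 0 :=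
  (R.curve (i + 1)).horizontal_ne hρ (R.β_pos _) (R.α_lt_one _).ne
    (by rw [← h0]; exact (R.α_strictAnti hρ (Nat.succ_pos i)).ne)

end Params.Regular

theorem IsCompensation.h_v_ne (hρ : 0 < ρ) (hρ₁ : ρ < 1) {P : Params}
    (hP : IsCompensation ρ P) (i : ℕ) : P.h i ≠ 0 ∧ P.v i ≠ 0 := by
  have R := hP.regular hρ hρ₁
  have hv : ∀ i, P.h i ≠ 0 → P.v i ≠ 0 := fun i hi => by
    rw [hP.v_eq]
    exact mul_ne_zero (neg_ne_zero.2 (div_ne_zero (sub_ne_zero.2 (R.α_succ_lt i).ne)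
      (sub_ne_zero.2 (R.β_lt_α hρ i).ne'))) hi
  have hh : P.h i ≠ 0 := by
    induction i with
    | zero => rw [hP.h_zero]; exact one_ne_zero
    | succ i ih =>
      rw [hP.h_succ]
      exact mul_ne_zero (neg_ne_zero.2 (div_ne_zero (R.horizontal_ne_succ hρ hP.α_zero i)
        (R.horizontal_ne hρ hP.α_zero i))) (hv i ih)
  exact ⟨hh, hv i hh⟩

/-! ### The initial term and the compensation steps -/

section Steps

variable {P : Params}

theorem IsCompensation.initial_balance (hρ : 0 < ρ) (hρ₁ : ρ < 1) (hP : IsCompensation ρ P) :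
    InteriorBalance ρ (P.hTerm 0) ∧ HorizontalBalance ρ (P.hTerm 0) := by
  have R := hP.regular hρ hρ₁
  -- At `α = ρ²`, `β = ρ²/(2 + ρ)` the factor of the horizontal defect is zero, so no partner is
  -- needed.
  refine ⟨(R.curve 0).interiorBalance _, horizontalBalance_single hρ (R.curve 0) _ ?_⟩
  rw [hP.α_zero, hP.β_zero]
  field_simp
  ring

theorem IsCompensation.vertical_step (hρ : 0 < ρ) (hρ₁ : ρ < 1) (hP : IsCompensation ρ P)
    (i : ℕ) : InteriorBalance ρ (fun m n => P.hTerm i m n + P.vTerm i m n) ∧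
      VerticalBalance ρ (fun m n => P.hTerm i m n + P.vTerm i m n) := by
  have R := hP.regular hρ hρ₁
  exact ⟨((R.curve i).interiorBalance _).add ((R.curve_succ i).interiorBalance _),
    verticalBalance_pair (R.curve i) (R.curve_succ i) (R.α_strictAnti hρ (Nat.lt_succ_self i)).ne'
      (sub_ne_zero.2 (R.β_lt_α hρ i).ne') (hP.v_eq i)⟩

theorem IsCompensation.horizontal_step (hρ : 0 < ρ) (hρ₁ : ρ < 1) (hP : IsCompensation ρ P)
    (i : ℕ) : InteriorBalance ρ (fun m n => P.vTerm i m n + P.hTerm (i + 1) m n) ∧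
      HorizontalBalance ρ (fun m n => P.vTerm i m n + P.hTerm (i + 1) m n) := by
  have R := hP.regular hρ hρ₁
  exact ⟨((R.curve_succ i).interiorBalance _).add ((R.curve (i + 1)).interiorBalance _),
    horizontalBalance_pair hρ (R.curve_succ i) (R.curve (i + 1)) (R.β_pos i).ne' (R.β_pos _).ne'
      (R.β_strictAnti hρ (Nat.lt_succ_self i)).ne' (R.horizontal_ne hρ hP.α_zero i) (hP.h_succ i)⟩

end Steps

end

end JSQ

namespace JSQ

noncomputable section

variable {ρ : ℝ} {P : Params}

/-! ### Limits of the ratios of consecutive terms -/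

theorem sqrt_one_add_sq_lt (hρ : 0 < ρ) : √(1 + ρ ^ 2) < 1 + ρ := by
  rw [Real.sqrt_lt' (by linarith)]
  nlinarith

theorem lt_sqrt_one_add_sq (ρ : ℝ) : ρ < √(1 + ρ ^ 2) := by
  apply Real.lt_sqrt_of_sq_lt
  linarith

theorem thetaMinus_pos (hρ : 0 < ρ) : 0 < thetaMinus ρ := by
  unfold thetaMinus; linarith [sqrt_one_add_sq_lt hρ]

theorem thetaMinus_lt_one (ρ : ℝ) : thetaMinus ρ < 1 := by
  unfold thetaMinus; linarith [lt_sqrt_one_add_sq ρ]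

theorem one_lt_thetaPlus (hρ : 0 < ρ) : 1 < thetaPlus ρ := by
  unfold thetaPlus; linarith [lt_sqrt_one_add_sq ρ]

theorem theta_ratio_lt_one (hρ : 0 < ρ) :
    (1 - thetaMinus ρ) / (thetaPlus ρ - 1) < 1 := by
  rw [div_lt_one (by linarith [one_lt_thetaPlus hρ])]
  unfold thetaMinus thetaPlus
  linarith

theorem theta_ratio_pos (hρ : 0 < ρ) : 0 < (1 - thetaMinus ρ) / (thetaPlus ρ - 1) :=
  div_pos (by linarith [thetaMinus_lt_one ρ]) (by linarith [one_lt_thetaPlus hρ])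

theorem theta_div_pos (hρ : 0 < ρ) : 0 < thetaMinus ρ / thetaPlus ρ :=
  div_pos (thetaMinus_pos hρ) (by linarith [one_lt_thetaPlus hρ])

theorem theta_div_lt_one (hρ : 0 < ρ) : thetaMinus ρ / thetaPlus ρ < 1 := by
  have h := one_lt_thetaPlus hρ
  rw [div_lt_one (by linarith)]
  linarith [thetaMinus_lt_one ρ]

theorem theta_ratio_mul_pow_lt_one (hρ : 0 < ρ) (k : ℕ) :
    (1 - thetaMinus ρ) / (thetaPlus ρ - 1) * (thetaMinus ρ / thetaPlus ρ) ^ k < 1 := by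
  have h1 := theta_ratio_lt_one hρ
  have h2 := theta_ratio_pos hρ
  have h3 : (thetaMinus ρ / thetaPlus ρ) ^ k ≤ 1 :=
    pow_le_one₀ (theta_div_pos hρ).le (theta_div_lt_one hρ).le
  nlinarith

theorem ratioSmall_zero (ρ : ℝ) : ratioSmall ρ 0 = thetaMinus ρ := by
  have : (2 * (1 + ρ) - 0) ^ 2 - 8 * ρ = 2 ^ 2 * (1 + ρ ^ 2) := by ring
  rw [ratioSmall, this, Real.sqrt_mul (by positivity), Real.sqrt_sq (by norm_num), thetaMinus]
  ring

theorem ratioLarge_zero (ρ : ℝ) : ratioLarge ρ 0 = thetaPlus ρ := by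
  rw [ratioLarge, sub_zero, thetaPlus]

theorem continuous_ratioSmall (ρ : ℝ) : Continuous (ratioSmall ρ) := by
  unfold ratioSmall; fun_prop

theorem continuous_ratioLarge (ρ : ℝ) : Continuous (ratioLarge ρ) := by
  unfold ratioLarge; fun_prop

namespace Params.Regular

theorem tendsto_α (R : P.Regular ρ) (hρ : 0 < ρ) : Tendsto P.α atTop (𝓝 0) := by
  have hle : ∀ i, P.α i ≤ (1 / (1 + ρ)) ^ i := by
    intro i
    induction i with
    | zero => simpa using (R.α_lt_one 0).le
    | succ i ih =>
      have h1 := R.α_succ_lt i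
      have h2 : P.β i ≤ P.α i * (1 / (1 + ρ)) := by
        rw [mul_one_div, le_div_iff₀ (by positivity)]
        linarith [R.β_lt i]
      calc P.α (i + 1) ≤ P.α i * (1 / (1 + ρ)) := h1.le.trans h2
        _ ≤ (1 / (1 + ρ)) ^ i * (1 / (1 + ρ)) := by gcongr
        _ = _ := (pow_succ _ _).symm
  refine squeeze_zero (fun i => (R.α_pos i).le) hle
    (tendsto_pow_atTop_nhds_zero_of_lt_one (by positivity) ?_)
  rw [div_lt_one (by positivity)]
  linarith

theorem tendsto_β (R : P.Regular ρ) (hρ : 0 < ρ) : Tendsto P.β atTop (𝓝 0) :=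
  squeeze_zero (fun i => (R.β_pos i).le) (fun i => (R.β_lt_α hρ i).le) (R.tendsto_α hρ)

theorem tendsto_ratio_vertical (R : P.Regular ρ) (hρ : 0 < ρ) :
    Tendsto (fun i => P.α (i + 1) / P.β i) atTop (𝓝 (thetaMinus ρ)) := by
  have h : (fun i => P.α (i + 1) / P.β i) = fun i => ratioSmall ρ (P.β i) := by
    ext i
    have := (R.β_pos i).ne'
    rw [R.α_succ_eq]; field_simp
  rw [h, ← ratioSmall_zero]
  exact ((continuous_ratioSmall ρ).tendsto 0).comp (R.tendsto_β hρ)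

theorem tendsto_ratio_horizontal (R : P.Regular ρ) (hρ : 0 < ρ) :
    Tendsto (fun i => P.α i / P.β i) atTop (𝓝 (thetaPlus ρ)) := by
  have h : (fun i => P.α i / P.β i) = fun i => ratioLarge ρ (P.α i) := by
    ext i
    have h1 := (R.α_pos i).ne'
    have h2 := R.β_eq i
    have h3 : ratioLarge ρ (P.α i) ≠ 0 := by
      linarith [(ratioLarge_spec (ρ := ρ) (R.α_lt_one i)).2]
    rw [h2]; field_simp
  rw [h, ← ratioLarge_zero]
  exact ((continuous_ratioLarge ρ).tendsto 0).comp (R.tendsto_α hρ)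

theorem tendsto_α_succ_div (R : P.Regular ρ) (hρ : 0 < ρ) :
    Tendsto (fun i => P.α (i + 1) / P.α i) atTop (𝓝 (thetaMinus ρ / thetaPlus ρ)) := by
  have h := (R.tendsto_ratio_vertical hρ).div (R.tendsto_ratio_horizontal hρ)
    (by linarith [one_lt_thetaPlus hρ])
  refine h.congr fun i => ?_
  have h1 := (R.β_pos i).ne'
  simp only [Pi.div_apply]
  field_simp

theorem tendsto_β_succ_div (R : P.Regular ρ) (hρ : 0 < ρ) :
    Tendsto (fun i => P.β (i + 1) / P.β i) atTop (𝓝 (thetaMinus ρ / thetaPlus ρ)) := by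
  have h := (R.tendsto_ratio_vertical hρ).div
    ((tendsto_add_atTop_iff_nat 1).2 (R.tendsto_ratio_horizontal hρ))
    (by linarith [one_lt_thetaPlus hρ])
  refine h.congr fun i => ?_
  have h1 := (R.β_pos i).ne'
  have h2 := (R.α_pos (i + 1)).ne'
  simp only [Pi.div_apply]
  field_simp

end Params.Regular

theorem IsCompensation.tendsto_v_div_h (hρ : 0 < ρ) (hρ₁ : ρ < 1) (hP : IsCompensation ρ P) :
    Tendsto (fun i => P.v i / P.h i) atTop
      (𝓝 ((1 - thetaMinus ρ) / (thetaPlus ρ - 1))) := by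
  have R := hP.regular hρ hρ₁
  have h := ((R.tendsto_ratio_vertical hρ).const_sub 1).div
    ((R.tendsto_ratio_horizontal hρ).sub_const 1) (by linarith [one_lt_thetaPlus hρ])
  refine h.congr fun i => ?_
  have h1 := (R.β_pos i).ne'
  have h2 := (hP.h_v_ne hρ hρ₁ i).1
  have h3 : P.α i - P.β i ≠ 0 := sub_ne_zero.2 (R.β_lt_α hρ i).ne'
  simp only [Pi.div_apply]
  rw [hP.v_eq, mul_div_assoc, div_self h2, mul_one, one_sub_div h1, div_sub_one h1,
    div_div_div_cancel_right₀ h1, ← neg_div, neg_sub]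

/-- Numerator and denominator both diverge. Multiplied by `α_{i+1}` they tend to `ρθ₊` and `ρθ₋`. -/
theorem IsCompensation.tendsto_h_succ_div_v (hρ : 0 < ρ) (hρ₁ : ρ < 1)
    (hP : IsCompensation ρ P) :
    Tendsto (fun i => P.h (i + 1) / P.v i) atTop (𝓝 (-(thetaPlus ρ / thetaMinus ρ))) := by
  have R := hP.regular hρ hρ₁
  have hα := (tendsto_add_atTop_iff_nat 1).2 (R.tendsto_α hρ)
  have hx := R.tendsto_ratio_vertical hρ
  have hu := (tendsto_add_atTop_iff_nat 1).2 (R.tendsto_ratio_horizontal hρ)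
  have hm := (thetaMinus_pos hρ).ne'
  have h := ((((hα.const_add ρ).mul hu).sub (hα.const_mul (1 + ρ))).div
    (((hα.const_add ρ).mul hx).sub (hα.const_mul (1 + ρ)))
    (by simpa using ⟨hρ.ne', hm⟩)).neg
  have e : -(((ρ + 0) * thetaPlus ρ - (1 + ρ) * 0) / ((ρ + 0) * thetaMinus ρ - (1 + ρ) * 0)) =
      -(thetaPlus ρ / thetaMinus ρ) := by
    have := hρ.ne'
    rw [add_zero, mul_zero, sub_zero, sub_zero, mul_div_mul_left _ _ this]
  rw [e] at h
  refine h.congr fun i => ?_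
  have h1 := (R.β_pos i).ne'
  have h2 := (hP.h_v_ne hρ hρ₁ i).2
  have h3 := (R.α_pos (i + 1)).ne'
  have h4 := (R.β_pos (i + 1)).ne'
  simp only [Pi.div_apply]
  rw [hP.h_succ, mul_div_assoc, div_self h2, mul_one]
  rw [show (ρ + P.α (i + 1)) * (P.α (i + 1) / P.β (i + 1)) - (1 + ρ) * P.α (i + 1) =
      P.α (i + 1) * ((ρ + P.α (i + 1)) / P.β (i + 1) - (1 + ρ)) by ring,
    show (ρ + P.α (i + 1)) * (P.α (i + 1) / P.β i) - (1 + ρ) * P.α (i + 1) =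
      P.α (i + 1) * ((ρ + P.α (i + 1)) / P.β i - (1 + ρ)) by ring,
    mul_div_mul_left _ _ h3]

theorem IsCompensation.tendsto_h_succ_div (hρ : 0 < ρ) (hρ₁ : ρ < 1) (hP : IsCompensation ρ P) :
    Tendsto (fun i => P.h (i + 1) / P.h i) atTop
      (𝓝 (-(thetaPlus ρ / thetaMinus ρ) * ((1 - thetaMinus ρ) / (thetaPlus ρ - 1)))) := by
  refine ((hP.tendsto_h_succ_div_v hρ hρ₁).mul (hP.tendsto_v_div_h hρ hρ₁)).congr fun i => ?_
  exact div_mul_div_cancel₀ (hP.h_v_ne hρ hρ₁ i).2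

theorem IsCompensation.tendsto_v_succ_div (hρ : 0 < ρ) (hρ₁ : ρ < 1) (hP : IsCompensation ρ P) :
    Tendsto (fun i => P.v (i + 1) / P.v i) atTop
      (𝓝 (-(thetaPlus ρ / thetaMinus ρ) * ((1 - thetaMinus ρ) / (thetaPlus ρ - 1)))) := by
  refine ((hP.tendsto_h_succ_div_v hρ hρ₁).mul
    ((tendsto_add_atTop_iff_nat 1).2 (hP.tendsto_v_div_h hρ hρ₁))).congr fun i => ?_
  rw [mul_comm]
  exact div_mul_div_cancel₀ (hP.h_v_ne hρ hρ₁ (i + 1)).1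

/-- The coefficient ratio contributes `θ₊/θ₋`, which cancels one of the `m + n` factors `θ₋/θ₊` of
the powers. Hence the exponent `m + n - 1` and the need for `n ≥ 1`. -/
theorem tendsto_abs_term_ratio (hρ : 0 < ρ) {c a b : ℕ → ℝ}
    (hc : Tendsto (fun i => c (i + 1) / c i) atTop
      (𝓝 (-(thetaPlus ρ / thetaMinus ρ) * ((1 - thetaMinus ρ) / (thetaPlus ρ - 1)))))
    (ha : Tendsto (fun i => a (i + 1) / a i) atTop (𝓝 (thetaMinus ρ / thetaPlus ρ)))
    (hb : Tendsto (fun i => b (i + 1) / b i) atTop (𝓝 (thetaMinus ρ / thetaPlus ρ)))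
    (m n : ℕ) (hn : 1 ≤ n) :
    Tendsto (fun i => |(c (i + 1) * a (i + 1) ^ m * b (i + 1) ^ n) / (c i * a i ^ m * b i ^ n)|)
      atTop (𝓝 ((1 - thetaMinus ρ) / (thetaPlus ρ - 1) *
        (thetaMinus ρ / thetaPlus ρ) ^ (m + n - 1))) := by
  obtain ⟨k, rfl⟩ := Nat.exists_eq_add_of_le' hn
  have h := ((hc.mul (ha.pow m)).mul (hb.pow (k + 1))).abs
  have h1 := (thetaMinus_pos hρ).ne'
  have h2 : thetaPlus ρ ≠ 0 := by linarith [one_lt_thetaPlus hρ]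
  have h3 : 0 ≤ (1 - thetaMinus ρ) / (thetaPlus ρ - 1) *
        (thetaMinus ρ / thetaPlus ρ) ^ (m + k) :=
    mul_nonneg (theta_ratio_pos hρ).le (pow_nonneg (theta_div_pos hρ).le _)
  have e : -(thetaPlus ρ / thetaMinus ρ) * ((1 - thetaMinus ρ) / (thetaPlus ρ - 1)) *
      (thetaMinus ρ / thetaPlus ρ) ^ m * (thetaMinus ρ / thetaPlus ρ) ^ (k + 1) =
      -((1 - thetaMinus ρ) / (thetaPlus ρ - 1) * (thetaMinus ρ / thetaPlus ρ) ^ (m + k)) := by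
    have : thetaPlus ρ / thetaMinus ρ * (thetaMinus ρ / thetaPlus ρ) = 1 := by field_simp
    rw [pow_succ, pow_add]
    linear_combination (-((1 - thetaMinus ρ) / (thetaPlus ρ - 1) *
      ((thetaMinus ρ / thetaPlus ρ) ^ m * (thetaMinus ρ / thetaPlus ρ) ^ k))) * this
  rw [e, abs_neg, abs_of_nonneg h3] at h
  simp only [show m + (k + 1) - 1 = m + k by omega]
  refine h.congr fun i => ?_
  rw [div_pow, div_pow, div_mul_div_comm, div_mul_div_comm]

theorem tendsto_normalized_ratio (hρ : 0 < ρ) {c a b : ℕ → ℝ} (ha0 : ∀ i, 0 < a i)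
    (hb0 : ∀ i, 0 < b i) (ha1 : ∀ i, a i < 1) (hb1 : ∀ i, b i < 1)
    (hc : Tendsto (fun i => c (i + 1) / c i) atTop
      (𝓝 (-(thetaPlus ρ / thetaMinus ρ) * ((1 - thetaMinus ρ) / (thetaPlus ρ - 1)))))
    (ha : Tendsto a atTop (𝓝 0)) (hb : Tendsto b atTop (𝓝 0))
    (hb' : Tendsto (fun i => b (i + 1) / b i) atTop (𝓝 (thetaMinus ρ / thetaPlus ρ))) :
    Tendsto (fun i => (|c (i + 1)| / (1 - |a (i + 1)|) * (|b (i + 1)| / (1 - |b (i + 1)|))) /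
      (|c i| / (1 - |a i|) * (|b i| / (1 - |b i|)))) atTop
      (𝓝 ((1 - thetaMinus ρ) / (thetaPlus ρ - 1))) := by
  have one : ∀ {d : ℕ → ℝ}, Tendsto d atTop (𝓝 0) →
      Tendsto (fun i => (1 - d i) / (1 - d (i + 1))) atTop (𝓝 1) := fun {d} hd => by
    have := (hd.const_sub 1).div (((tendsto_add_atTop_iff_nat 1).2 hd).const_sub 1) (by norm_num)
    simpa [Pi.div_def] using this
  have hk : Tendsto (fun i => |c (i + 1) / c i| * (b (i + 1) / b i)) atTop
      (𝓝 ((1 - thetaMinus ρ) / (thetaPlus ρ - 1))) := by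
    convert hc.abs.mul hb' using 2
    have h1 := (thetaMinus_pos hρ).ne'
    have h2 : 0 < thetaPlus ρ := by linarith [one_lt_thetaPlus hρ]
    rw [abs_mul, abs_neg, abs_of_pos (theta_ratio_pos hρ),
      abs_of_pos (div_pos h2 (thetaMinus_pos hρ))]
    have := h2.ne'
    field_simp
  have h := (hk.mul (one ha)).mul (one hb)
  rw [mul_one, mul_one] at h
  refine h.congr fun i => ?_
  have h1 : 1 - a i ≠ 0 := by linarith [ha1 i]
  have h2 : 1 - a (i + 1) ≠ 0 := by linarith [ha1 (i + 1)]
  have h3 : 1 - b i ≠ 0 := by linarith [hb1 i]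
  have h4 : 1 - b (i + 1) ≠ 0 := by linarith [hb1 (i + 1)]
  have h5 := (hb0 i).ne'
  rw [abs_div, abs_of_pos (ha0 i), abs_of_pos (ha0 (i + 1)), abs_of_pos (hb0 i),
    abs_of_pos (hb0 (i + 1))]
  by_cases hc0 : c i = 0
  · simp [hc0]
  · have := abs_ne_zero.2 hc0
    field_simp

/-! ### Summability -/

/-- This is the ratio test at `m = 0`, `n = 1`, where the limiting ratio is largest; all other terms
are later dominated by this case. -/
theorem IsCompensation.summable_h_mul_β (hρ : 0 < ρ) (hρ₁ : ρ < 1) (hP : IsCompensation ρ P) :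
    Summable (fun i => |P.h i| * P.β i) := by
  have R := hP.regular hρ hρ₁
  have h := tendsto_abs_term_ratio hρ (hP.tendsto_h_succ_div hρ hρ₁) (R.tendsto_α_succ_div hρ)
    (R.tendsto_β_succ_div hρ) 0 1 le_rfl
  simp only [pow_zero, mul_one, pow_one] at h
  refine summable_of_ratio_test_tendsto_lt_one (theta_ratio_mul_pow_lt_one hρ (0 + 1 - 1))
    (Eventually.of_forall fun i => mul_ne_zero (abs_ne_zero.2 (hP.h_v_ne hρ hρ₁ i).1)
      (R.β_pos i).ne') ?_
  refine h.congr fun i => ?_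
  simp [abs_div, abs_mul]

theorem IsCompensation.summable_v_mul_β (hρ : 0 < ρ) (hρ₁ : ρ < 1) (hP : IsCompensation ρ P) :
    Summable (fun i => |P.v i| * P.β i) := by
  have R := hP.regular hρ hρ₁
  have h := tendsto_abs_term_ratio hρ (hP.tendsto_v_succ_div hρ hρ₁) (R.tendsto_α_succ_div hρ)
    (R.tendsto_β_succ_div hρ) 0 1 le_rfl
  simp only [pow_zero, mul_one, pow_one] at h
  refine summable_of_ratio_test_tendsto_lt_one (theta_ratio_mul_pow_lt_one hρ (0 + 1 - 1))
    (Eventually.of_forall fun i => mul_ne_zero (abs_ne_zero.2 (hP.h_v_ne hρ hρ₁ i).2)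
      (R.β_pos i).ne') ?_
  refine h.congr fun i => ?_
  simp [abs_div, abs_mul]

/-- One factor `b i` stays with the coefficient and makes the sum over `i` converge; the remaining
powers are bounded by geometric series independent of `i`. The weights `y`, `z` allow for growing
test functions. -/
theorem summable_productForm {c a b : ℕ → ℝ} {y z A B : ℝ} (hy : 0 ≤ y) (hz : 0 ≤ z)
    (ha0 : ∀ i, 0 ≤ a i) (hb0 : ∀ i, 0 ≤ b i) (hA : ∀ i, a i * y ≤ A) (hA1 : A < 1)
    (hB : ∀ i, b i * z ≤ B) (hB1 : B < 1) (hc : Summable fun i => |c i| * b i) :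
    Summable (fun t : ℕ × ℕ × ℕ =>
      |c t.1 * a t.1 ^ t.2.1 * b t.1 ^ (t.2.2 + 1)| * (y ^ t.2.1 * z ^ (t.2.2 + 1))) := by
  have hA0 : 0 ≤ A := (mul_nonneg (ha0 0) hy).trans (hA 0)
  have hB0 : 0 ≤ B := (mul_nonneg (hb0 0) hz).trans (hB 0)
  have hg : Summable (fun s : ℕ × ℕ => A ^ s.1 * B ^ s.2) :=
    (summable_geometric_of_lt_one hA0 hA1).mul_of_nonneg (summable_geometric_of_lt_one hB0 hB1)
      (fun i => pow_nonneg hA0 i) (fun i => pow_nonneg hB0 i)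
  have hs : Summable (fun t : ℕ × ℕ × ℕ => |c t.1| * b t.1 * z * (A ^ t.2.1 * B ^ t.2.2)) :=
    (hc.mul_right z).mul_of_nonneg hg
      (fun i => mul_nonneg (mul_nonneg (abs_nonneg _) (hb0 i)) hz)
      (fun s => mul_nonneg (pow_nonneg hA0 _) (pow_nonneg hB0 _))
  refine Summable.of_nonneg_of_le (fun t => by positivity) (fun t => ?_) hs
  obtain ⟨i, m, n⟩ := t
  have hai := ha0 i
  have hbi := hb0 i
  simp only
  rw [abs_mul, abs_mul, abs_of_nonneg (pow_nonneg hai m), abs_of_nonneg (pow_nonneg hbi (n + 1))]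
  calc |c i| * a i ^ m * b i ^ (n + 1) * (y ^ m * z ^ (n + 1))
      = |c i| * b i * z * ((a i * y) ^ m * (b i * z) ^ n) := by
        rw [mul_pow, mul_pow]; ring
    _ ≤ |c i| * b i * z * (A ^ m * B ^ n) := by
        gcongr
        · exact hA i
        · exact hB i

theorem summable_tsum_of_triple {F : ℕ → ℕ → ℕ → ℝ} {w : ℕ → ℕ → ℝ} (hw : ∀ m n, 0 ≤ w m n)
    (h : Summable (fun t : ℕ × ℕ × ℕ => |F t.1 t.2.1 (t.2.2 + 1)| * w t.2.1 (t.2.2 + 1))) :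
    Summable (fun s : ℕ × ℕ => |∑' i, F i s.1 (s.2 + 1)| * w s.1 (s.2 + 1)) := by
  have h1 := h.prod_symm.prod
  refine Summable.of_nonneg_of_le (fun s => mul_nonneg (abs_nonneg _) (hw _ _)) (fun s => ?_) h1
  have h2 : Summable fun i => |F i s.1 (s.2 + 1)| * w s.1 (s.2 + 1) := h.prod_symm.prod_factor s
  simp only [Prod.swap_prod_mk]
  -- A zero weight gives no summability in `i`, but then both sides are zero.
  by_cases h0 : w s.1 (s.2 + 1) = 0
  · simp [h0]
  · rw [tsum_mul_right]
    refine mul_le_mul_of_nonneg_right ?_ (hw _ _)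
    rw [summable_mul_right_iff h0] at h2
    exact norm_tsum_le_tsum_norm (f := fun i => F i s.1 (s.2 + 1)) h2

/-! ### Extension to the diagonal -/

/-- The extension of `f` to the states `(m, 0)`. -/
def fill (ρ : ℝ) (f : ℕ → ℕ → ℝ) (m n : ℕ) : ℝ :=
  if n = 0 then
    if m = 0 then f 0 1 / ρ else (2 * ρ * f (m - 1) 1 + f m 1) / (1 + ρ)
  else f m n

@[simp] theorem fill_zero_zero (f : ℕ → ℕ → ℝ) : fill ρ f 0 0 = f 0 1 / ρ := by simp [fill]

@[simp] theorem fill_succ_zero (f : ℕ → ℕ → ℝ) (m : ℕ) :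
    fill ρ f (m + 1) 0 = (2 * ρ * f m 1 + f (m + 1) 1) / (1 + ρ) := by simp [fill]

@[simp] theorem fill_succ (f : ℕ → ℕ → ℝ) (m n : ℕ) : fill ρ f m (n + 1) = f m (n + 1) := by
  simp [fill]

theorem extend_natCast (ρ : ℝ) (f : ℕ → ℕ → ℝ) (m n : ℕ) :
    extend ρ f (m, ((n : ℕ) : ℤ)) = fill ρ f m n := by
  simp [extend, fill]

theorem extend_neg (ρ : ℝ) (f : ℕ → ℕ → ℝ) (m : ℕ) (n : ℤ) :
    extend ρ f (m, -n) = extend ρ f (m, n) := by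
  simp [extend]

theorem extend_toMinDiff (ρ : ℝ) (f : ℕ → ℕ → ℝ) (x : ℕ × ℕ) :
    extend ρ f (toMinDiff x) = fold (fill ρ f) x := by
  obtain ⟨m, n, rfl | rfl | rfl⟩ := exists_eq_lt_or_gt_or_diag x
  · have : toMinDiff (m, m) = (m, ((0 : ℕ) : ℤ)) := by simp [toMinDiff]
    rw [this, extend_natCast, fold_diag]
  · have : toMinDiff (m, m + (n + 1)) = (m, ((n + 1 : ℕ) : ℤ)) := by simp [toMinDiff]
    rw [this, extend_natCast, fold_lt]
  · have : toMinDiff (m + (n + 1), m) = (m, -((n + 1 : ℕ) : ℤ)) := by simp [toMinDiff]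
    rw [this, extend_neg, extend_natCast, fold_gt]

/-- The values on the diagonal are defined so as to solve these equations, whatever `f` is. -/
theorem defect_fill_diag (hρ : 0 < ρ) (f : ℕ → ℕ → ℝ) (m : ℕ) :
    defect ρ (fold (fill ρ f)) (m, m) = 0 := by
  rw [defect_fold_diag]
  have h1 : 1 + ρ ≠ 0 := by positivity
  cases m with
  | zero => simp [fill]; field_simp; ring
  | succ m => simp [fill]; field_simp; ring

theorem defect_fill_interior {f : ℕ → ℕ → ℝ} (h : InteriorBalance ρ f) (m n : ℕ) :
    defect ρ (fold (fill ρ f)) (m + 1, m + 1 + (n + 1 + 1)) = 0 := by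
  have := h (m + 1) (n + 2) (by omega) (by omega)
  simp only [Nat.add_sub_cancel, show n + 2 - 1 = n + 1 by omega] at this
  rw [defect_fold_lt]
  simp only [fill_succ, Nat.add_eq_zero_iff, one_ne_zero, and_false, if_false, Nat.add_sub_cancel]
  linear_combination this

theorem defect_fill_horizontal {f : ℕ → ℕ → ℝ} (h : HorizontalBalance ρ f) (m : ℕ) :
    defect ρ (fold (fill ρ f)) (m + 1, m + 1 + (0 + 1)) = 0 := by
  have := h (m + 1) (by omega)
  simp only [Nat.add_sub_cancel] at this
  rw [defect_fold_lt]
  simp only [fill_succ, fill_succ_zero, Nat.add_eq_zero_iff, one_ne_zero, and_false, if_false,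
    if_true, Nat.add_sub_cancel, zero_add]
  linear_combination this

theorem defect_fill_vertical {f : ℕ → ℕ → ℝ} (h : VerticalBalance ρ f) (n : ℕ) :
    defect ρ (fold (fill ρ f)) (0, 0 + (n + 1 + 1)) = 0 := by
  have := h (n + 2) (by omega)
  simp only [show n + 2 - 1 = n + 1 by omega] at this
  rw [defect_fold_lt]
  simp only [fill_succ, Nat.add_eq_zero_iff, one_ne_zero, and_false, if_false, if_true, zero_add]
  linear_combination this

theorem defect_fill_corner (hρ : 0 < ρ) (f : ℕ → ℕ → ℝ) :
    defect ρ (fold (fill ρ f)) (0, 0 + (0 + 1)) = (1 + 2 * ρ) * f 0 1 -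
      (f 0 2 + 1 / (1 + ρ) * (2 * ρ * f 0 1 + f 1 1) + f 0 1) := by
  rw [defect_fold_lt]
  have e := fill_succ_zero (ρ := ρ) f 0
  have e1 := fill_succ (ρ := ρ) f 0 0
  have e2 := fill_succ (ρ := ρ) f 0 1
  simp only [zero_add] at e e1 e2
  simp only [zero_add, if_true, e, e1, e2, fill_zero_zero]
  field_simp
  ring

theorem defect_fill_eq_zero_of_ne (hρ : 0 < ρ) {f : ℕ → ℕ → ℝ} (hI : InteriorBalance ρ f)
    (hV : VerticalBalance ρ f) (hH : HorizontalBalance ρ f) {x : ℕ × ℕ} (h1 : x ≠ (0, 1))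
    (h2 : x ≠ (1, 0)) : defect ρ (fold (fill ρ f)) x = 0 := by
  have key : ∀ m n, (m, n) ≠ (0, 0) →
      defect ρ (fold (fill ρ f)) (m, m + (n + 1)) = 0 := by
    rintro (_ | m) (_ | n) hmn
    · exact absurd rfl hmn
    · exact defect_fill_vertical hV n
    · exact defect_fill_horizontal hH m
    · exact defect_fill_interior hI m n
  obtain ⟨m, n, rfl | rfl | rfl⟩ := exists_eq_lt_or_gt_or_diag x
  · exact defect_fill_diag hρ f m
  · refine key m n fun h => h1 ?_
    obtain ⟨rfl, rfl⟩ := Prod.mk.inj h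
    rfl
  · rw [defect_fold_swap]
    refine key m n fun h => h2 ?_
    obtain ⟨rfl, rfl⟩ := Prod.mk.inj h
    rfl

theorem defect_fill_eq_zero (hρ : 0 < ρ) {f : ℕ → ℕ → ℝ} (hI : InteriorBalance ρ f)
    (hV : VerticalBalance ρ f) (hH : HorizontalBalance ρ f) (hO : CornerBalance ρ f)
    (x : ℕ × ℕ) : defect ρ (fold (fill ρ f)) x = 0 := by
  have h0 : defect ρ (fold (fill ρ f)) (0, 1) = 0 := by
    have := defect_fill_corner hρ f
    rw [show ((0 : ℕ), 0 + (0 + 1)) = (0, 1) from rfl] at this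
    rw [this]
    unfold CornerBalance at hO
    linear_combination hO
  by_cases h1 : x = (0, 1)
  · rw [h1, h0]
  by_cases h2 : x = (1, 0)
  · rw [h2, defect_fold_swap, h0]
  exact defect_fill_eq_zero_of_ne hρ hI hV hH h1 h2

theorem summable_fold_fill (hρ : 0 < ρ) {f : ℕ → ℕ → ℝ} {y z : ℝ} (hy : 1 ≤ y) (hz : 1 ≤ z)
    (h : Summable fun t : ℕ × ℕ => |f t.1 (t.2 + 1)| * (y ^ t.1 * z ^ (t.2 + 1))) :
    Summable fun x => |fold (fill ρ f) x| * fold (fun m n => y ^ m * z ^ n) x := by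
  change Summable (fold fun m n => |fill ρ f m n| * (y ^ m * z ^ n))
  refine summable_fold ?_ (by simpa using h)
  have ha : Summable fun m => |f m 1| * y ^ m := by
    have hi : Function.Injective fun m : ℕ => ((m, 0) : ℕ × ℕ) := fun m n h => by simp_all
    refine Summable.of_nonneg_of_le (fun m => by positivity) (fun m => ?_) (h.comp_injective hi)
    simp only [Function.comp_apply, zero_add, pow_one]
    gcongr
    exact le_mul_of_one_le_right (by positivity) hz
  rw [← summable_nat_add_iff 1]
  refine Summable.of_nonneg_of_le (fun m => by positivity) (fun m => ?_)
    ((ha.mul_left (2 * ρ * y)).add ((summable_nat_add_iff 1).2 ha))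
  rw [fill_succ_zero, pow_zero, mul_one, abs_div, abs_of_pos (by positivity : 0 < 1 + ρ)]
  calc |2 * ρ * f m 1 + f (m + 1) 1| / (1 + ρ) * y ^ (m + 1)
      ≤ |2 * ρ * f m 1 + f (m + 1) 1| * y ^ (m + 1) := by
        gcongr
        exact div_le_self (abs_nonneg _) (by linarith)
    _ ≤ (2 * ρ * |f m 1| + |f (m + 1) 1|) * y ^ (m + 1) := by
        gcongr
        refine (abs_add_le _ _).trans_eq ?_
        rw [abs_mul, abs_of_pos (by positivity : 0 < 2 * ρ)]
    _ = _ := by ring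

theorem summable_fold_fill_one (hρ : 0 < ρ) {f : ℕ → ℕ → ℝ}
    (h : Summable fun t : ℕ × ℕ => |f t.1 (t.2 + 1)|) : Summable (fold (fill ρ f)) := by
  have := summable_fold_fill hρ (f := f) le_rfl le_rfl (by simpa using h)
  rw [← summable_abs_iff]
  simpa [fold] using this

/-- The balance equation of the corner follows from all the others. -/
theorem cornerBalance_of_others (hρ : 0 < ρ) {f : ℕ → ℕ → ℝ}
    (h : Summable fun t : ℕ × ℕ => |f t.1 (t.2 + 1)|) (hI : InteriorBalance ρ f)
    (hV : VerticalBalance ρ f) (hH : HorizontalBalance ρ f) : CornerBalance ρ f := by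
  -- The generator annihilates constants, so the defects sum to zero. Only `(0, 1)` and `(1, 0)` can
  -- contribute, and by symmetry equally.
  have key := tsum_defect_mul_fold hρ (K := 1) (φ := fun _ _ => 1) le_rfl le_rfl (by simp)
    (summable_fold_fill hρ (f := f) le_rfl le_rfl (by simpa using h))
  have hg : ∀ x, negGen ρ (fold fun _ _ => (1 : ℝ)) x = 0 := fun x => by
    simp [negGen, jump, outRate, fold, joinRate_add]
  simp only [hg, mul_zero, tsum_zero] at key
  rw [tsum_eq_sum (s := {((0 : ℕ), (1 : ℕ)), (1, 0)})] at key
  · rw [Finset.sum_pair (by simp), defect_fold_swap ρ _ 0 1] at key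
    have e := defect_fill_corner hρ f
    rw [show ((0 : ℕ), 0 + (0 + 1)) = (0, 1) from rfl] at e
    have h1 : ∀ x, fold (fun _ _ => (1 : ℝ)) x = 1 := fun _ => rfl
    simp only [h1, mul_one] at key
    unfold CornerBalance
    have key' : defect ρ (fold (fill ρ f)) (0, 1) = 0 := by linarith
    rw [e] at key'
    linarith
  · intro x hx
    simp only [Finset.mem_insert, Finset.mem_singleton, not_or] at hx
    rw [defect_fill_eq_zero_of_ne hρ hI hV hH hx.1 hx.2, zero_mul]

/-! ### The series -/

theorem InteriorBalance.of_hasSum {F : ℕ → ℕ → ℕ → ℝ} {f : ℕ → ℕ → ℝ}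
    (hF : ∀ i, InteriorBalance ρ (F i))
    (h : ∀ m n, 1 ≤ n → HasSum (fun i => F i m n) (f m n)) : InteriorBalance ρ f := by
  intro m n hm hn
  refine ((h m n (by omega)).mul_left (2 * (1 + ρ))).unique ?_
  simp only [fun i => hF i m n hm hn]
  exact (((h _ _ (by omega)).mul_left _).add (h _ _ (by omega))).add (h _ _ (by omega))

theorem VerticalBalance.of_hasSum {F : ℕ → ℕ → ℕ → ℝ} {f : ℕ → ℕ → ℝ}
    (hF : ∀ i, VerticalBalance ρ (F i))
    (h : ∀ m n, 1 ≤ n → HasSum (fun i => F i m n) (f m n)) : VerticalBalance ρ f := by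
  intro n hn
  refine ((h 0 n (by omega)).mul_left (1 + 2 * ρ)).unique ?_
  simp only [fun i => hF i n hn]
  exact (h _ _ (by omega)).add (h _ _ (by omega))

theorem HorizontalBalance.of_hasSum {F : ℕ → ℕ → ℕ → ℝ} {f : ℕ → ℕ → ℝ}
    (hF : ∀ i, HorizontalBalance ρ (F i))
    (h : ∀ m n, 1 ≤ n → HasSum (fun i => F i m n) (f m n)) : HorizontalBalance ρ f := by
  intro m hm
  refine ((h m 1 le_rfl).mul_left (2 * (1 + ρ))).unique ?_
  simp only [fun i => hF i m hm]
  exact ((((h _ _ (by omega)).mul_left _).add (h _ _ (by omega))).add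
    ((((h _ _ le_rfl).mul_left _).add (h _ _ le_rfl)).mul_left _)).add
    ((((h _ _ le_rfl).mul_left _).add (h _ _ le_rfl)).mul_left _)

theorem HorizontalBalance.add {f g : ℕ → ℕ → ℝ} (hf : HorizontalBalance ρ f)
    (hg : HorizontalBalance ρ g) : HorizontalBalance ρ (fun m n => f m n + g m n) := by
  intro m hm
  linear_combination hf m hm + hg m hm

theorem IsCompensation.summable_hTerm_weighted (hρ : 0 < ρ) (hρ₁ : ρ < 1)
    (hP : IsCompensation ρ P) {y z : ℝ} (k : ℕ) (hy : 0 ≤ y) (hz : 0 ≤ z) (hy1 : P.α k * y < 1)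
    (hz1 : P.β k * z < 1) :
    Summable (fun t : ℕ × ℕ × ℕ =>
      |P.hTerm (t.1 + k) t.2.1 (t.2.2 + 1)| * (y ^ t.2.1 * z ^ (t.2.2 + 1))) := by
  have R := hP.regular hρ hρ₁
  refine summable_productForm (c := fun i => P.h (i + k)) (a := fun i => P.α (i + k))
    (b := fun i => P.β (i + k)) hy hz (fun i => (R.α_pos _).le) (fun i => (R.β_pos _).le)
    (fun i => ?_) hy1 (fun i => ?_) hz1 ((summable_nat_add_iff k).2 (hP.summable_h_mul_β hρ hρ₁))
  · exact mul_le_mul_of_nonneg_right ((R.α_strictAnti hρ).antitone (by omega)) hy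
  · exact mul_le_mul_of_nonneg_right ((R.β_strictAnti hρ).antitone (by omega)) hz

theorem IsCompensation.summable_vTerm_weighted (hρ : 0 < ρ) (hρ₁ : ρ < 1)
    (hP : IsCompensation ρ P) {y z : ℝ} (hy : 0 ≤ y) (hz : 0 ≤ z) (hy1 : P.α 1 * y < 1)
    (hz1 : P.β 0 * z < 1) :
    Summable (fun t : ℕ × ℕ × ℕ =>
      |P.vTerm t.1 t.2.1 (t.2.2 + 1)| * (y ^ t.2.1 * z ^ (t.2.2 + 1))) := by
  have R := hP.regular hρ hρ₁
  refine summable_productForm (c := P.v) (a := fun i => P.α (i + 1))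
    (b := P.β) hy hz (fun i => (R.α_pos _).le) (fun i => (R.β_pos _).le)
    (fun i => ?_) hy1 (fun i => ?_) hz1 (hP.summable_v_mul_β hρ hρ₁)
  · exact mul_le_mul_of_nonneg_right ((R.α_strictAnti hρ).antitone (by omega)) hy
  · exact mul_le_mul_of_nonneg_right ((R.β_strictAnti hρ).antitone (by omega)) hz

theorem IsCompensation.summable_abs_hTerm_triple (hρ : 0 < ρ) (hρ₁ : ρ < 1)
    (hP : IsCompensation ρ P) :
    Summable (fun t : ℕ × ℕ × ℕ => |P.hTerm t.1 t.2.1 (t.2.2 + 1)|) := by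
  have R := hP.regular hρ hρ₁
  simpa using hP.summable_hTerm_weighted hρ hρ₁ (y := 1) (z := 1) 0 zero_le_one zero_le_one
    (by simpa using R.α_lt_one 0) (by simpa using R.β_lt_one hρ 0)

theorem IsCompensation.summable_abs_vTerm_triple (hρ : 0 < ρ) (hρ₁ : ρ < 1)
    (hP : IsCompensation ρ P) :
    Summable (fun t : ℕ × ℕ × ℕ => |P.vTerm t.1 t.2.1 (t.2.2 + 1)|) := by
  have R := hP.regular hρ hρ₁
  simpa using hP.summable_vTerm_weighted hρ hρ₁ (y := 1) (z := 1) zero_le_one zero_le_one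
    (by simpa using R.α_lt_one 1) (by simpa using R.β_lt_one hρ 0)

theorem IsCompensation.summable_abs_terms (hρ : 0 < ρ) (hρ₁ : ρ < 1)
    (hP : IsCompensation ρ P) (m n : ℕ) (hn : 1 ≤ n) :
    Summable (fun i => |P.hTerm i m n|) ∧ Summable (fun i => |P.vTerm i m n|) := by
  obtain ⟨k, rfl⟩ := Nat.exists_eq_add_of_le' hn
  have hi : Function.Injective fun i : ℕ => ((i, m, k) : ℕ × ℕ × ℕ) := fun i j h => by simp_all
  have h1 := (hP.summable_abs_hTerm_triple hρ hρ₁).comp_injective hi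
  have h2 := (hP.summable_abs_vTerm_triple hρ hρ₁).comp_injective hi
  simp only [Function.comp_def] at h1 h2
  exact ⟨h1, h2⟩

theorem IsCompensation.hasSum_series (hρ : 0 < ρ) (hρ₁ : ρ < 1)
    (hP : IsCompensation ρ P) (m n : ℕ) (hn : 1 ≤ n) :
    HasSum (fun i => P.hTerm i m n + P.vTerm i m n) (P.series m n) := by
  obtain ⟨h1, h2⟩ := hP.summable_abs_terms hρ hρ₁ m n hn
  exact h1.of_abs.hasSum.add h2.of_abs.hasSum

/-- The series without its first term. -/
def Params.tail (P : Params) (m n : ℕ) : ℝ :=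
  (∑' i, P.vTerm i m n) + ∑' i, P.hTerm (i + 1) m n

theorem IsCompensation.hasSum_tail (hρ : 0 < ρ) (hρ₁ : ρ < 1)
    (hP : IsCompensation ρ P) (m n : ℕ) (hn : 1 ≤ n) :
    HasSum (fun i => P.vTerm i m n + P.hTerm (i + 1) m n) (P.tail m n) := by
  obtain ⟨h1, h2⟩ := hP.summable_abs_terms hρ hρ₁ m n hn
  exact h2.of_abs.hasSum.add ((summable_nat_add_iff 1).2 h1.of_abs).hasSum

theorem IsCompensation.series_eq (hρ : 0 < ρ) (hρ₁ : ρ < 1)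
    (hP : IsCompensation ρ P) (m n : ℕ) (hn : 1 ≤ n) :
    P.series m n = P.hTerm 0 m n + P.tail m n := by
  obtain ⟨h1, -⟩ := hP.summable_abs_terms hρ hρ₁ m n hn
  rw [Params.series, Params.tail, h1.of_abs.tsum_eq_zero_add]
  ring

theorem IsCompensation.interiorBalance_series (hρ : 0 < ρ) (hρ₁ : ρ < 1)
    (hP : IsCompensation ρ P) : InteriorBalance ρ P.series :=
  .of_hasSum (fun i => (hP.vertical_step hρ hρ₁ i).1) (hP.hasSum_series hρ hρ₁)

theorem IsCompensation.verticalBalance_series (hρ : 0 < ρ) (hρ₁ : ρ < 1)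
    (hP : IsCompensation ρ P) : VerticalBalance ρ P.series :=
  .of_hasSum (fun i => (hP.vertical_step hρ hρ₁ i).2) (hP.hasSum_series hρ hρ₁)

/-- Absolute convergence allows `v_i` to be regrouped with `h_{i+1}`; the initial term left over
satisfies (H) by itself. -/
theorem IsCompensation.horizontalBalance_series (hρ : 0 < ρ) (hρ₁ : ρ < 1)
    (hP : IsCompensation ρ P) : HorizontalBalance ρ P.series := by
  have h := (hP.initial_balance hρ hρ₁).2.add
    (.of_hasSum (fun i => (hP.horizontal_step hρ hρ₁ i).2) (hP.hasSum_tail hρ hρ₁))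
  intro m hm
  simpa only [hP.series_eq hρ hρ₁ _ 1 le_rfl, hP.series_eq hρ hρ₁ _ 2 one_le_two] using h m hm

theorem summable_weighted_add {f F G : ℕ → ℕ → ℝ} {w : ℕ → ℕ → ℝ} (hw : ∀ m n, 0 ≤ w m n)
    (hf : ∀ m n, f m n = F m n + G m n)
    (hF : Summable fun s : ℕ × ℕ => |F s.1 (s.2 + 1)| * w s.1 (s.2 + 1))
    (hG : Summable fun s : ℕ × ℕ => |G s.1 (s.2 + 1)| * w s.1 (s.2 + 1)) :
    Summable fun s : ℕ × ℕ => |f s.1 (s.2 + 1)| * w s.1 (s.2 + 1) := by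
  refine Summable.of_nonneg_of_le (fun s => mul_nonneg (abs_nonneg _) (hw _ _)) (fun s => ?_)
    (hF.add hG)
  rw [hf, ← add_mul]
  exact mul_le_mul_of_nonneg_right (abs_add_le _ _) (hw _ _)

theorem IsCompensation.summable_series_weighted (hρ : 0 < ρ) (hρ₁ : ρ < 1)
    (hP : IsCompensation ρ P) {y z : ℝ} (hy : 0 ≤ y) (hz : 0 ≤ z) (hy1 : P.α 0 * y < 1)
    (hz1 : P.β 0 * z < 1) :
    Summable fun s : ℕ × ℕ => |P.series s.1 (s.2 + 1)| * (y ^ s.1 * z ^ (s.2 + 1)) := by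
  have R := hP.regular hρ hρ₁
  have hw : ∀ m n : ℕ, 0 ≤ y ^ m * z ^ n := fun m n => by positivity
  have hα := (R.α_strictAnti hρ (Nat.zero_lt_one)).le
  refine summable_weighted_add (w := fun m n => y ^ m * z ^ n) hw (fun m n => rfl)
    (summable_tsum_of_triple (w := fun m n => y ^ m * z ^ n) hw
      (hP.summable_hTerm_weighted hρ hρ₁ 0 hy hz hy1 hz1))
    (summable_tsum_of_triple (w := fun m n => y ^ m * z ^ n) hw
      (hP.summable_vTerm_weighted hρ hρ₁ hy hz
        ((mul_le_mul_of_nonneg_right hα hy).trans_lt hy1) hz1))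

/-- Without its first term the series tolerates `y` up to `1/α₁` instead of `1/α₀`, in particular `y
= 1/ρ²`. -/
theorem IsCompensation.summable_tail_weighted (hρ : 0 < ρ) (hρ₁ : ρ < 1)
    (hP : IsCompensation ρ P) {y z : ℝ} (hy : 0 ≤ y) (hz : 0 ≤ z) (hy1 : P.α 1 * y < 1)
    (hz1 : P.β 0 * z < 1) :
    Summable fun s : ℕ × ℕ => |P.tail s.1 (s.2 + 1)| * (y ^ s.1 * z ^ (s.2 + 1)) := by
  have R := hP.regular hρ hρ₁
  have hw : ∀ m n : ℕ, 0 ≤ y ^ m * z ^ n := fun m n => by positivity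
  have hβ := (R.β_strictAnti hρ (Nat.zero_lt_one)).le
  refine summable_weighted_add (w := fun m n => y ^ m * z ^ n) hw (fun m n => rfl)
    (summable_tsum_of_triple (w := fun m n => y ^ m * z ^ n) hw
      (hP.summable_vTerm_weighted hρ hρ₁ hy hz hy1 hz1))
    (summable_tsum_of_triple (F := fun i => P.hTerm (i + 1)) (w := fun m n => y ^ m * z ^ n) hw
      (hP.summable_hTerm_weighted hρ hρ₁ 1 hy hz hy1
        ((mul_le_mul_of_nonneg_right hβ hz).trans_lt hz1)))

theorem IsCompensation.summable_abs_series (hρ : 0 < ρ) (hρ₁ : ρ < 1)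
    (hP : IsCompensation ρ P) : Summable fun s : ℕ × ℕ => |P.series s.1 (s.2 + 1)| := by
  have R := hP.regular hρ hρ₁
  simpa using hP.summable_series_weighted hρ hρ₁ (y := 1) (z := 1) zero_le_one zero_le_one
    (by simpa using R.α_lt_one 0) (by simpa using R.β_lt_one hρ 0)

theorem IsCompensation.cornerBalance_series (hρ : 0 < ρ) (hρ₁ : ρ < 1)
    (hP : IsCompensation ρ P) : CornerBalance ρ P.series :=
  cornerBalance_of_others hρ (hP.summable_abs_series hρ hρ₁) (hP.interiorBalance_series hρ hρ₁)
    (hP.verticalBalance_series hρ hρ₁) (hP.horizontalBalance_series hρ hρ₁)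

theorem IsCompensation.defect_series (hρ : 0 < ρ) (hρ₁ : ρ < 1)
    (hP : IsCompensation ρ P) (x : ℕ × ℕ) : defect ρ (fold (fill ρ P.series)) x = 0 :=
  defect_fill_eq_zero hρ (hP.interiorBalance_series hρ hρ₁) (hP.verticalBalance_series hρ hρ₁)
    (hP.horizontalBalance_series hρ hρ₁) (hP.cornerBalance_series hρ hρ₁) x

/-! ### The normalization constant -/

/-- The weights `ρ ^ (-n)` on the boundary `m = 0`, doubled at the origin. -/
def bdry (ρ : ℝ) (m n : ℕ) : ℝ := if m = 0 then (if n = 0 then 2 else (1 / ρ) ^ n) else 0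

/-- A function that the generator maps to `-bdry` plus a constant. -/
def testTotal (ρ : ℝ) (m n : ℕ) : ℝ :=
  (2 - ρ) * (∑ k ∈ Finset.range m, (1 / (2 * ρ)) ^ (k + 1) - (2 * m + n)) +
    (1 / (2 * ρ)) ^ m * (1 / ρ) ^ n

/-- A function that the generator maps to a multiple of `bdry`. -/
def testResidue (ρ : ℝ) (m n : ℕ) : ℝ := (1 / ρ ^ 2) ^ m * (1 / ρ) ^ n

/-- The number of jobs is `2m + n`, with drift `2ρ - 2` while both servers are busy; this gives the
constant. The monomial `(2ρ)^(-m) ρ^(-n)` is annihilated for `m, n ≥ 1` and yields `ρ^(-n)` for `m =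
0`, `n ≥ 1`. The geometric sum cancels what the job count leaves on `m = 0`, `n ≥ 1` and what the
monomial leaves on the diagonal `m ≥ 1`. -/
theorem negGen_testTotal (hρ : 0 < ρ) (x : ℕ × ℕ) :
    negGen ρ (fold (testTotal ρ)) x = fold (bdry ρ) x - 2 * (1 - ρ) * (2 - ρ) := by
  have hρ' := hρ.ne'
  have off : ∀ m n, negGen ρ (fold (testTotal ρ)) (m, m + (n + 1)) =
      fold (bdry ρ) (m, m + (n + 1)) - 2 * (1 - ρ) * (2 - ρ) := by
    intro m n
    rw [negGen_fold_lt, fold_lt]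
    cases m with
    | zero =>
      simp only [testTotal, bdry, Finset.range_zero, Finset.sum_empty, zero_add,
        Finset.sum_range_one, if_true, pow_succ, pow_zero, Nat.add_eq_zero_iff, one_ne_zero,
        and_false, if_false]
      generalize (1 / ρ) ^ n = Z
      push_cast
      field_simp
      ring
    | succ m =>
      simp only [testTotal, bdry, Finset.sum_range_succ, pow_succ, Nat.add_eq_zero_iff,
        one_ne_zero, and_false, if_false, Nat.add_sub_cancel]
      generalize (1 / ρ) ^ n = Z
      generalize (1 / (2 * ρ)) ^ m = Y
      push_cast
      field_simp
      ring
  obtain ⟨m, n, rfl | rfl | rfl⟩ := exists_eq_lt_or_gt_or_diag x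
  · rw [negGen_fold_diag, fold_diag]
    cases m with
    | zero =>
      simp [testTotal, bdry]
      field_simp
      ring
    | succ m =>
      simp only [testTotal, bdry, Finset.sum_range_succ, pow_succ, Nat.add_eq_zero_iff,
        one_ne_zero, and_false, if_false, Nat.add_sub_cancel, pow_zero]
      generalize (1 / (2 * ρ)) ^ m = Y
      push_cast
      field_simp
      ring
  · exact off m n
  · rw [negGen_fold_swap, fold_swap, off]

/-- The test function is `ρ^(-N)`, `N = 2m + n` the number of jobs. Arrivals and two busy servers
balance, `2ρ(1 - 1/ρ) + 2(1 - ρ) = 0`, and each idle server removes one term `(1 - ρ)ρ^(-N)`.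
Accordingly `bdry` is the number of idle servers times `ρ^(-N)`. -/
theorem negGen_testResidue (hρ : 0 < ρ) (x : ℕ × ℕ) :
    negGen ρ (fold (testResidue ρ)) x = -(1 - ρ) * fold (bdry ρ) x := by
  have hρ' := hρ.ne'
  have off : ∀ m n, negGen ρ (fold (testResidue ρ)) (m, m + (n + 1)) =
      -(1 - ρ) * fold (bdry ρ) (m, m + (n + 1)) := by
    intro m n
    rw [negGen_fold_lt, fold_lt]
    cases m with
    | zero =>
      simp only [testResidue, bdry, zero_add, if_true, pow_succ, pow_zero, Nat.add_eq_zero_iff,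
        one_ne_zero, and_false, if_false]
      generalize (1 / ρ) ^ n = Z
      field_simp
      ring
    | succ m =>
      simp only [testResidue, bdry, pow_succ, Nat.add_eq_zero_iff,
        one_ne_zero, and_false, if_false, Nat.add_sub_cancel]
      generalize (1 / ρ) ^ n = Z
      generalize (1 / (1 * ρ * ρ)) ^ m = Y
      field_simp
      ring
  obtain ⟨m, n, rfl | rfl | rfl⟩ := exists_eq_lt_or_gt_or_diag x
  · rw [negGen_fold_diag, fold_diag]
    cases m with
    | zero =>
      simp [testResidue, bdry]
      field_simp
    | succ m =>
      simp only [testResidue, bdry, pow_succ, Nat.add_eq_zero_iff,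
        one_ne_zero, and_false, if_false, Nat.add_sub_cancel, pow_zero]
      field_simp
      ring
  · exact off m n
  · rw [negGen_fold_swap, fold_swap, off]

theorem abs_testTotal_le (hρ : 0 < ρ) (hρ₁ : ρ < 1) (m n : ℕ) :
    |testTotal ρ m n| ≤ ((2 - ρ) * (1 / (1 - ρ) + 3 * (1 / (1 / ρ - 1))) + 1) *
      ((1 / ρ) ^ m * (1 / ρ) ^ n) := by
  have hw : 1 < 1 / ρ := by rw [lt_div_iff₀ hρ]; linarith
  have h1ρ : 0 < 1 - ρ := by linarith
  set w := 1 / ρ with hwdef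
  have hρw : ρ * w = 1 := by rw [hwdef]; field_simp
  have hyw : 1 / (2 * ρ) ≤ w := by
    rw [hwdef]
    exact one_div_le_one_div_of_le hρ (by linarith)
  have hy0 : 0 ≤ 1 / (2 * ρ) := by positivity
  set y := 1 / (2 * ρ)
  have hm1 : ∀ k : ℕ, 1 ≤ w ^ k := fun k => one_le_pow₀ hw.le
  have hG0 : 0 ≤ ∑ k ∈ Finset.range m, y ^ (k + 1) :=
    Finset.sum_nonneg fun k _ => pow_nonneg hy0 _
  have hG : ∑ k ∈ Finset.range m, y ^ (k + 1) ≤ 1 / (1 - ρ) * w ^ m := by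
    clear hG0
    induction m with
    | zero => simp; linarith
    | succ m ih =>
      rw [Finset.sum_range_succ]
      have h2 : y ^ (m + 1) ≤ w ^ (m + 1) := pow_le_pow_left₀ hy0 hyw _
      -- Here `w ^ m = ρ * w ^ (m + 1)`, and `1/(1 - ρ)` is the constant for which the induction
      -- closes exactly.
      have h3 : 1 / (1 - ρ) * w ^ m + w ^ (m + 1) = 1 / (1 - ρ) * w ^ (m + 1) := by
        have e : 1 / (1 - ρ) * (1 - ρ) = 1 := one_div_mul_cancel h1ρ.ne'
        rw [pow_succ]
        linear_combination (-w ^ m * w) * e + (-(1 / (1 - ρ)) * w ^ m) * hρw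
      linarith
  have hlin : ∀ k : ℕ, (k : ℝ) ≤ 1 / (w - 1) * w ^ k := by
    intro k
    have h2 := one_add_mul_le_pow (a := w - 1) (by linarith) k
    have h3 : 0 < w - 1 := by linarith
    rw [add_sub_cancel] at h2
    rw [one_div, inv_mul_eq_div, le_div_iff₀ h3]
    linarith
  have hK : 0 < 1 / (w - 1) := by
    have : 0 < w - 1 := by linarith
    positivity
  have hmn1 : w ^ m ≤ w ^ m * w ^ n := le_mul_of_one_le_right (by positivity) (hm1 n)
  have hmn2 : w ^ n ≤ w ^ m * w ^ n := le_mul_of_one_le_left (by positivity) (hm1 m)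
  have b1 : (m : ℝ) ≤ 1 / (w - 1) * (w ^ m * w ^ n) :=
    (hlin m).trans (mul_le_mul_of_nonneg_left hmn1 hK.le)
  have b2 : (n : ℝ) ≤ 1 / (w - 1) * (w ^ m * w ^ n) :=
    (hlin n).trans (mul_le_mul_of_nonneg_left hmn2 hK.le)
  have b3 : ∑ k ∈ Finset.range m, y ^ (k + 1) ≤ 1 / (1 - ρ) * (w ^ m * w ^ n) :=
    hG.trans (mul_le_mul_of_nonneg_left hmn1 (by positivity))
  have b4 : y ^ m * w ^ n ≤ w ^ m * w ^ n := by gcongr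
  have b5 : |∑ k ∈ Finset.range m, y ^ (k + 1) - (2 * m + n)| ≤
      (1 / (1 - ρ) + 3 * (1 / (w - 1))) * (w ^ m * w ^ n) := by
    have hm0 : (0 : ℝ) ≤ m := Nat.cast_nonneg m
    have hn0 : (0 : ℝ) ≤ n := Nat.cast_nonneg n
    have hr : 0 ≤ 1 / (1 - ρ) * (w ^ m * w ^ n) := by positivity
    rw [abs_le]
    constructor <;> linarith
  unfold testTotal
  refine (abs_add_le _ _).trans ?_
  rw [abs_mul, abs_of_pos (by linarith : 0 < 2 - ρ),
    abs_of_nonneg (by positivity : 0 ≤ y ^ m * w ^ n)]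
  have := mul_le_mul_of_nonneg_left b5 (by linarith : 0 ≤ 2 - ρ)
  linarith

theorem summable_mul_fold_bdry (hρ : 0 < ρ) {y : ℝ} {Q : ℕ × ℕ → ℝ} (hy : 1 ≤ y)
    (hQ : Summable fun x => |Q x| * fold (fun m n => y ^ m * (1 / ρ) ^ n) x) :
    Summable fun x => Q x * fold (bdry ρ) x := by
  refine Summable.of_norm_bounded (hQ.mul_left 2) fun x => ?_
  have hb : ∀ m n, |bdry ρ m n| ≤ 2 * (y ^ m * (1 / ρ) ^ n) := by
    intro m n
    have h0 : 0 ≤ (1 / ρ) ^ n := by positivity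
    unfold bdry
    split_ifs with h1 h2
    · simp [h1, h2]
    · rw [abs_of_nonneg h0, h1, pow_zero, one_mul]; linarith
    · rw [abs_zero]; positivity
  rw [Real.norm_eq_abs, abs_mul]
  calc |Q x| * |fold (bdry ρ) x| ≤ |Q x| * (2 * fold (fun m n => y ^ m * (1 / ρ) ^ n) x) :=
        mul_le_mul_of_nonneg_left (hb _ _) (abs_nonneg _)
    _ = _ := by ring

theorem defect_add (ρ : ℝ) (Q Q' : ℕ × ℕ → ℝ) (x : ℕ × ℕ) :
    defect ρ (fun x => Q x + Q' x) x = defect ρ Q x + defect ρ Q' x := by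
  simp only [defect, inflow]
  split_ifs <;> ring

theorem fill_congr_add {f g k : ℕ → ℕ → ℝ} (h : ∀ m n, 1 ≤ n → f m n = g m n + k m n) (m n : ℕ) :
    fill ρ f m n = fill ρ g m n + fill ρ k m n := by
  unfold fill
  split_ifs with h1 h2
  · rw [h 0 1 le_rfl]; ring
  · rw [h _ 1 le_rfl, h _ 1 le_rfl]; ring
  · exact h m n (by omega)

/-- A function on the quadrant that depends on the minimum and the difference only,
supported on the axes. -/
theorem hasSum_symm_boundary {g : ℕ × ℕ → ℝ} {a b : ℝ} (hsymm : ∀ i j, g (j, i) = g (i, j))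
    (hg : ∀ m n, m ≠ 0 → g (m, m + n) = 0) (h0 : g (0, 0) = a)
    (h1 : HasSum (fun n => g (0, n + 1)) b) : HasSum g (a + b + b) := by
  have hi : Function.Injective fun n : ℕ => ((0, n) : ℕ × ℕ) := fun m n h => by simp_all
  have hoff : HasSum (fun t : ℕ × ℕ => g (t.1, t.1 + t.2 + 1)) b := by
    rw [← hi.hasSum_iff]
    · simpa [Function.comp_def] using h1
    · rintro ⟨m, n⟩ hmn
      have hm : m ≠ 0 := by
        rintro rfl
        exact hmn ⟨n, rfl⟩
      simpa only [add_assoc] using hg m (n + 1) hm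
  refine hasSum_of_hasSum_parts ?_ hoff ?_
  · rw [← h0]
    exact hasSum_single 0 fun m hm => by simpa using hg m 0 hm
  · simpa only [hsymm] using hoff

theorem IsCompensation.hTerm_zero (hP : IsCompensation ρ P) (m n : ℕ) :
    P.hTerm 0 m n = (ρ ^ 2) ^ m * (ρ ^ 2 / (2 + ρ)) ^ n := by
  rw [Params.hTerm, hP.h_zero, hP.α_zero, hP.β_zero, one_mul]

theorem hasSum_geometric_boundary (hρ : 0 < ρ) :
    HasSum (fun n : ℕ => (ρ / (2 + ρ)) ^ (n + 1)) (ρ / 2) := by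
  have hq : ρ / (2 + ρ) < 1 := by rw [div_lt_one (by positivity)]; linarith
  have h := (hasSum_geometric_of_lt_one (by positivity) hq).mul_left (ρ / (2 + ρ))
  simp only [← pow_succ'] at h
  rw [show 1 - ρ / (2 + ρ) = 2 / (2 + ρ) by field_simp; ring] at h
  rw [show ρ / 2 = ρ / (2 + ρ) * (2 / (2 + ρ))⁻¹ by field_simp]
  exact h

theorem IsCompensation.hasSum_initial_bdry (hρ : 0 < ρ) (hP : IsCompensation ρ P) :
    HasSum (fun x => fold (fill ρ (P.hTerm 0)) x * fold (bdry ρ) x)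
      (2 * ρ / (2 + ρ) + ρ / 2 + ρ / 2) := by
  refine hasSum_symm_boundary (fun i j => ?_) (fun m n hm => ?_) ?_ ?_
  · rw [fold_swap (fill ρ _) i j, fold_swap (bdry ρ) i j]
  · rw [fold_lt, fold_lt, bdry, if_neg hm, mul_zero]
  · rw [fold_diag, fold_diag, fill_zero_zero, hP.hTerm_zero]
    simp [bdry]
    field_simp
  · convert hasSum_geometric_boundary hρ using 2 with n
    have e1 := fold_lt (fill ρ (P.hTerm 0)) 0 (n + 1)
    have e2 := fold_lt (bdry ρ) 0 (n + 1)
    rw [zero_add] at e1 e2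
    rw [e1, e2, fill_succ, hP.hTerm_zero]
    simp only [bdry, if_true, Nat.add_eq_zero_iff, one_ne_zero, and_false, if_false, pow_zero,
      one_mul]
    rw [← mul_pow]
    congr 1
    field_simp

/-- The initial term violates only (V) and (O), so its defect lives on the two axes. Against
`ρ^(-N)` it becomes geometric; the separate summand `ρ/((1 + ρ)(2 + ρ))` corrects the state `(0,
1)`, where (O) replaces (V). -/
theorem IsCompensation.hasSum_initial_defect (hρ : 0 < ρ) (hρ₁ : ρ < 1)
    (hP : IsCompensation ρ P) :
    HasSum (fun x => defect ρ (fold (fill ρ (P.hTerm 0))) x * fold (testResidue ρ) x)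
      (0 + (-((2 - ρ) / (2 + ρ)) * (ρ / 2) + ρ / ((1 + ρ) * (2 + ρ))) +
        (-((2 - ρ) / (2 + ρ)) * (ρ / 2) + ρ / ((1 + ρ) * (2 + ρ)))) := by
  obtain ⟨hI, hH⟩ := hP.initial_balance hρ hρ₁
  refine hasSum_symm_boundary (fun i j => ?_) (fun m n hm => ?_) ?_ ?_
  · rw [fold_swap, defect_fold_swap]
  · obtain ⟨m, rfl⟩ := Nat.exists_eq_succ_of_ne_zero hm
    rcases n with _ | _ | n
    · rw [add_zero, defect_fill_diag hρ, zero_mul]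
    · rw [defect_fill_horizontal hH, zero_mul]
    · rw [defect_fill_interior hI, zero_mul]
  · rw [defect_fill_diag hρ, zero_mul]
  · have hs := ((hasSum_geometric_boundary hρ).mul_left (-((2 - ρ) / (2 + ρ)))).add
      (hasSum_ite_eq (0 : ℕ) (ρ / ((1 + ρ) * (2 + ρ))))
    have key : ∀ n : ℕ, defect ρ (fold (fill ρ (P.hTerm 0))) (0, n + 1) *
        fold (testResidue ρ) (0, n + 1) = -((2 - ρ) / (2 + ρ)) * (ρ / (2 + ρ)) ^ (n + 1) +
        if n = 0 then ρ / ((1 + ρ) * (2 + ρ)) else 0 := by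
      intro n
      have e2 := fold_lt (testResidue ρ) 0 (n + 1)
      rw [zero_add] at e2
      rw [e2]
      rcases n with _ | n
      · have e1 := defect_fill_corner hρ (P.hTerm 0)
        rw [show ((0 : ℕ), 0 + (0 + 1)) = (0, 0 + 1) from rfl] at e1
        rw [e1]
        simp only [hP.hTerm_zero, testResidue]
        simp
        field_simp
        ring
      · have e1 := defect_fold_lt ρ (fill ρ (P.hTerm 0)) 0 (n + 1)
        rw [zero_add] at e1
        rw [e1]
        simp only [fill_succ, hP.hTerm_zero, testResidue]
        simp only [Nat.add_eq_zero_iff, one_ne_zero, and_false, if_false, if_true, pow_succ,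
          pow_zero, div_pow]
        field_simp
        ring
    rw [funext key]
    exact hs

/-- Two linear equations determine the total. Testing `p` with `testTotal` gives total times `2(1 -
ρ)(2 - ρ)` as the boundary sum of `p`. Testing the tail `r` with `testResidue` gives the boundary
sum of `r`, because the defect of `r` is minus that of the initial term; the boundary sum of the
initial term is explicit. -/
theorem IsCompensation.hasSum_fold_fill_series (hρ : 0 < ρ) (hρ₁ : ρ < 1)
    (hP : IsCompensation ρ P) : HasSum (fold (fill ρ P.series)) (normConst ρ) := by
  have R := hP.regular hρ hρ₁
  have hw : 1 ≤ 1 / ρ := by rw [le_div_iff₀ hρ]; linarith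
  have hw2 : 1 ≤ 1 / ρ ^ 2 := by rw [le_div_iff₀ (by positivity)]; nlinarith
  have hβ : P.β 0 * (1 / ρ) < 1 := by
    rw [hP.β_zero, mul_one_div, div_lt_one hρ, div_lt_iff₀ (by positivity)]
    nlinarith
  have hα0 : P.α 0 * (1 / ρ) < 1 := by
    rw [hP.α_zero, mul_one_div, div_lt_one hρ]; nlinarith
  -- This strict inequality fails for `α₀ = ρ²`, which is why `testResidue` is paired with the tail
  -- only.
  have hα1 : P.α 1 * (1 / ρ ^ 2) < 1 := by
    rw [mul_one_div, div_lt_one (by positivity), ← hP.α_zero]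
    exact R.α_strictAnti hρ Nat.zero_lt_one
  have hs := summable_fold_fill hρ hw hw
    (hP.summable_series_weighted hρ hρ₁ (by positivity) (by positivity) hα0 hβ)
  have ht := summable_fold_fill hρ hw2 hw
    (hP.summable_tail_weighted hρ hρ₁ (by positivity) (by positivity) hα1 hβ)
  set p := fold (fill ρ P.series) with hp
  set r := fold (fill ρ P.tail) with hr
  set p₀ := fold (fill ρ (P.hTerm 0)) with hp₀
  have hsum : Summable p := summable_fold_fill_one hρ (hP.summable_abs_series hρ hρ₁)
  have hadd : p = fun x => p₀ x + r x := funext fun x =>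
    fill_congr_add (hP.series_eq hρ hρ₁) _ _
  have hpB := summable_mul_fold_bdry hρ hw hs
  have hrB := summable_mul_fold_bdry hρ hw2 ht
  -- the total mass in terms of the boundary
  have h1 := tsum_defect_mul_fold hρ hw hw (abs_testTotal_le hρ hρ₁) hs
  have h1' : ∀ x, p x * negGen ρ (fold (testTotal ρ)) x =
      p x * fold (bdry ρ) x - p x * (2 * (1 - ρ) * (2 - ρ)) := fun x => by
    rw [negGen_testTotal hρ, mul_sub]
  rw [tsum_congr h1'] at h1
  simp only [hp, hP.defect_series hρ hρ₁, zero_mul, tsum_zero] at h1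
  rw [← hp, hpB.tsum_sub (hsum.mul_right _), tsum_mul_right] at h1
  -- the boundary in terms of the initial term
  have h2 := tsum_defect_mul_fold hρ hw2 hw (K := 1) (φ := testResidue ρ) (fun m n => by
    rw [testResidue, abs_of_nonneg (by positivity), one_mul]) ht
  have hd : ∀ x, defect ρ r x = -defect ρ p₀ x := fun x => by
    have := hP.defect_series hρ hρ₁ x
    rw [← hp, hadd, defect_add] at this
    linarith
  have h3 : ∑' x, r x * negGen ρ (fold (testResidue ρ)) x =
      -(1 - ρ) * ∑' x, r x * fold (bdry ρ) x := by
    rw [← tsum_mul_left]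
    exact tsum_congr fun x => by rw [negGen_testResidue hρ]; ring
  simp only [hd, neg_mul, tsum_neg] at h2
  rw [h3, (hP.hasSum_initial_defect hρ hρ₁).tsum_eq] at h2
  have h4 : ∑' x, p x * fold (bdry ρ) x =
      (2 * ρ / (2 + ρ) + ρ / 2 + ρ / 2) + ∑' x, r x * fold (bdry ρ) x := by
    have hi := hP.hasSum_initial_bdry hρ
    rw [← hi.tsum_eq, ← hi.summable.tsum_add hrB]
    exact tsum_congr fun x => by rw [hadd]; ring
  rw [h4] at h1
  have hval : ∑' x, p x = normConst ρ := by
    generalize ∑' x, p x = T at h1 ⊢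
    generalize ∑' x, r x * fold (bdry ρ) x = W at h1 h2
    have k1 : 1 - ρ ≠ 0 := by linarith
    have k2 : 2 - ρ ≠ 0 := by linarith
    have hW : W = (0 + (-((2 - ρ) / (2 + ρ)) * (ρ / 2) + ρ / ((1 + ρ) * (2 + ρ))) +
        (-((2 - ρ) / (2 + ρ)) * (ρ / 2) + ρ / ((1 + ρ) * (2 + ρ)))) / (1 - ρ) := by
      rw [eq_div_iff k1]
      linarith
    have hT : T = (2 * ρ / (2 + ρ) + ρ / 2 + ρ / 2 + W) / (2 * (1 - ρ) * (2 - ρ)) := by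
      rw [eq_div_iff (mul_ne_zero (mul_ne_zero two_ne_zero k1) k2)]
      linarith
    rw [hT, hW, normConst]
    have k4 : 1 + ρ ≠ 0 := by linarith
    have k5 : 2 + ρ ≠ 0 := by linarith
    rw [show 1 - ρ ^ 2 = (1 - ρ) * (1 + ρ) by ring]
    field_simp
    ring
  rw [← hval]
  exact hsum.hasSum

/-! ### The equilibrium distribution -/

theorem normConst_pos (hρ : 0 < ρ) (hρ₁ : ρ < 1) : 0 < normConst ρ := by
  have h1 : 0 < 1 - ρ ^ 2 := by nlinarith
  have h2 : 0 < 2 - ρ := by linarith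
  unfold normConst
  positivity

theorem tsum_rateX_le (ρ : ℝ) (x : ℕ × ℕ) : ∑' y, rateX ρ x y ≤ 2 * ρ + 2 :=
  (hasSum_rateX ρ x).tsum_eq ▸ outRate_le ρ x

/-- A summable solution of the balance equations of `X` is a multiple of the series. -/
theorem IsCompensation.eq_of_balance_rateX (hρ : 0 < ρ) (hρ₁ : ρ < 1) (hP : IsCompensation ρ P)
    {Q : ℕ × ℕ → ℝ} {t : ℝ} (hQ : HasSum Q t) (hb : SatisfiesBalance (rateX ρ) Q) (x : ℕ × ℕ) :
    Q x = t / normConst ρ * fold (fill ρ P.series) x := by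
  have hC := (normConst_pos hρ hρ₁).ne'
  have hs := hP.hasSum_fold_fill_series hρ hρ₁
  have hsb := satisfiesBalance_rateX_iff.2 (hP.defect_series hρ hρ₁)
  -- The multiple is chosen so that the difference has total zero.
  have h0 : HasSum (fun x => Q x + -(t / normConst ρ) * fold (fill ρ P.series) x) 0 := by
    have := hQ.add (hs.mul_left (-(t / normConst ρ)))
    rwa [neg_mul, div_mul_cancel₀ _ hC, add_neg_cancel] at this
  have := (hb.add (hsb.const_mul (-(t / normConst ρ)))).eq_zero_of_hasSum_zero
    (rateX_nonneg hρ.le) (fun x => (hasSum_rateX ρ x).summable) (tsum_rateX_le ρ)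
    (fun p hp hpb => eq_zero_of_balance_rateX hρ hp hpb) h0 x
  linarith

/-- Nonnegativity comes from the constant sign of summable solutions together with the positive
total. -/
theorem IsCompensation.isEquilibrium_rateX (hρ : 0 < ρ) (hρ₁ : ρ < 1)
    (hP : IsCompensation ρ P) :
    IsEquilibrium (rateX ρ) (fun x => (normConst ρ)⁻¹ * fold (fill ρ P.series) x) := by
  have hC := normConst_pos hρ hρ₁
  have hs := hP.hasSum_fold_fill_series hρ hρ₁
  have hsb := satisfiesBalance_rateX_iff.2 (hP.defect_series hρ hρ₁)
  refine ⟨fun x => mul_nonneg (inv_nonneg.2 hC.le) ?_, ?_, hsb.const_mul _⟩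
  · rcases hsb.nonneg_or_nonpos (rateX_nonneg hρ.le) (fun x => (hasSum_rateX ρ x).summable)
      (tsum_rateX_le ρ) (fun p hp hpb => eq_zero_of_balance_rateX hρ hp hpb) hs.summable
      with h | h
    · exact h x
    · exact absurd (hasSum_le h hs hasSum_zero) (not_le.2 hC)
  · have := hs.mul_left (normConst ρ)⁻¹
    rwa [inv_mul_cancel₀ hC.ne'] at this

theorem IsCompensation.isEquilibrium_rateX_iff (hρ : 0 < ρ) (hρ₁ : ρ < 1)
    (hP : IsCompensation ρ P) {Q : ℕ × ℕ → ℝ} : IsEquilibrium (rateX ρ) Q ↔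
      Q = fun x => (normConst ρ)⁻¹ * fold (fill ρ P.series) x := by
  constructor
  · intro h
    funext x
    rw [hP.eq_of_balance_rateX hρ hρ₁ h.hasSum_one h.balance x, one_div]
  · rintro rfl
    exact hP.isEquilibrium_rateX hρ hρ₁

/-! ### Transfer to `Y`, and consequences for the series -/

theorem isEquilibrium_rateY_iff (ρ : ℝ) (p : ℕ × ℤ → ℝ) :
    IsEquilibrium (rateY ρ) p ↔ IsEquilibrium (rateX ρ) (p ∘ toMinDiff) := by
  rw [← isEquilibrium_comp_equiv toMinDiff]
  simp only [rateY, Equiv.symm_apply_apply]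

theorem IsCompensation.isEquilibrium_rateY_iff (hρ : 0 < ρ) (hρ₁ : ρ < 1)
    (hP : IsCompensation ρ P) {p : ℕ × ℤ → ℝ} : IsEquilibrium (rateY ρ) p ↔
      p = fun y => (normConst ρ)⁻¹ * extend ρ P.series y := by
  rw [JSQ.isEquilibrium_rateY_iff, hP.isEquilibrium_rateX_iff hρ hρ₁]
  constructor
  · intro h
    funext y
    have := congrFun h (toMinDiff.symm y)
    rwa [← extend_toMinDiff, Function.comp_apply, Equiv.apply_symm_apply] at this
  · rintro rfl
    funext x
    rw [Function.comp_apply, extend_toMinDiff]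

theorem IsCompensation.hasSum_extend_series (hρ : 0 < ρ) (hρ₁ : ρ < 1)
    (hP : IsCompensation ρ P) : HasSum (extend ρ P.series) (normConst ρ) := by
  rw [← toMinDiff.hasSum_iff]
  have := hP.hasSum_fold_fill_series hρ hρ₁
  rwa [← funext (extend_toMinDiff ρ P.series)] at this

/-- A series vanishing identically would have an extension with total zero instead of `C > 0`. -/
theorem IsCompensation.exists_series_ne_zero (hρ : 0 < ρ) (hρ₁ : ρ < 1)
    (hP : IsCompensation ρ P) : ∃ m n : ℕ, 1 ≤ n ∧ P.series m n ≠ 0 := by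
  by_contra! h
  have h0 : fold (fill ρ P.series) = fun _ => 0 := by
    have hf : ∀ m n, fill ρ P.series m n = 0 := fun m n => by
      unfold fill
      split_ifs with h1 h2
      · rw [h 0 1 le_rfl, zero_div]
      · rw [h _ 1 le_rfl, h _ 1 le_rfl]; simp
      · exact h m n (by omega)
    exact funext fun x => hf _ _
  have hs := hP.hasSum_fold_fill_series hρ hρ₁
  rw [h0] at hs
  exact (normConst_pos hρ hρ₁).ne' (hs.unique hasSum_zero)

theorem IsCompensation.eq_const_mul_series (hρ : 0 < ρ) (hρ₁ : ρ < 1)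
    (hP : IsCompensation ρ P) {f : ℕ → ℕ → ℝ} (hf : Summable fun s : ℕ × ℕ => |f s.1 (s.2 + 1)|)
    (hI : InteriorBalance ρ f) (hV : VerticalBalance ρ f) (hH : HorizontalBalance ρ f)
    (hO : CornerBalance ρ f) : ∃ c : ℝ, ∀ m n : ℕ, 1 ≤ n → f m n = c * P.series m n := by
  refine ⟨(∑' x, fold (fill ρ f) x) / normConst ρ, fun m n hn => ?_⟩
  obtain ⟨k, rfl⟩ := Nat.exists_eq_add_of_le' hn
  have := hP.eq_of_balance_rateX hρ hρ₁ (summable_fold_fill_one hρ hf).hasSum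
    (satisfiesBalance_rateX_iff.2 (defect_fill_eq_zero hρ hI hV hH hO)) (m, m + (k + 1))
  rwa [fold_lt, fold_lt, fill_succ, fill_succ] at this

theorem IsCompensation.equilibrium_formulas (hρ : 0 < ρ) (hρ₁ : ρ < 1)
    (hP : IsCompensation ρ P) {p : ℕ × ℤ → ℝ} (hp : IsEquilibrium (rateY ρ) p) :
    (∀ m n : ℕ, 1 ≤ n → p (m, (n : ℤ)) = (normConst ρ)⁻¹ *
      ∑' i, (P.h i * P.α i ^ m + P.v i * P.α (i + 1) ^ m) * P.β i ^ n) ∧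
    (∀ m n : ℕ, p (m, -(n : ℤ)) = p (m, (n : ℤ))) ∧
    (∀ m : ℕ, 1 ≤ m → p (m, 0) = (2 * ρ * p (m - 1, 1) + p (m, 1)) / (1 + ρ)) ∧
    p (0, 0) = p (0, 1) / ρ := by
  rw [hP.isEquilibrium_rateY_iff hρ hρ₁] at hp
  subst hp
  have e0 : ∀ m, extend ρ P.series (m, 0) = fill ρ P.series m 0 := fun m =>
    extend_natCast ρ P.series m 0
  have e1 : ∀ m, extend ρ P.series (m, 1) = P.series m 1 := fun m =>
    (extend_natCast ρ P.series m 1).trans (fill_succ P.series m 0)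
  refine ⟨fun m n hn => ?_, fun m n => ?_, fun m hm => ?_, ?_⟩
  · obtain ⟨k, rfl⟩ := Nat.exists_eq_add_of_le' hn
    simp only [extend_natCast, fill_succ]
    rw [← (hP.hasSum_series hρ hρ₁ m (k + 1) hn).tsum_eq]
    simp only [Params.hTerm, Params.vTerm, add_mul]
  · simp only [extend_neg]
  · obtain ⟨k, rfl⟩ := Nat.exists_eq_add_of_le' hm
    simp only [e0, e1, fill_succ_zero, Nat.add_sub_cancel]
    ring
  · simp only [e0, e1, fill_zero_zero]
    ring

end

end JSQ

/-! ### The main theorem -/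

theorem mainTheorem1 (ρ : ℝ) (hρ₀ : 0 < ρ) (hρ₁ : ρ < 1) :
    -- the compensation procedure is well defined
    (∃! P : JSQ.Params, JSQ.IsCompensation ρ P) ∧
    -- the equilibrium distribution exists and is unique, for both state descriptions
    (∃! p : ℕ × ℤ → ℝ, JSQ.IsEquilibrium (JSQ.rateY ρ) p) ∧
    (∃! π : ℕ × ℕ → ℝ, JSQ.IsEquilibrium (JSQ.rateX ρ) π) ∧
    (∀ p : ℕ × ℤ → ℝ, JSQ.IsEquilibrium (JSQ.rateY ρ) p ↔
      JSQ.IsEquilibrium (JSQ.rateX ρ) (p ∘ JSQ.toMinDiff)) ∧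
    (∀ P : JSQ.Params, JSQ.IsCompensation ρ P →
      -- ordering of the parameters; all terms and all denominators are nonzero
      (∀ i, 0 < P.β i ∧ P.β i < P.α i ∧ 0 < P.α (i + 1) ∧ P.α (i + 1) < P.β i ∧ P.α i < 1 ∧
        P.h i ≠ 0 ∧ P.v i ≠ 0 ∧ (ρ + P.α (i + 1)) / P.β i - (1 + ρ) ≠ 0) ∧
      -- each new parameter is the only complex root in the respective open disc
      (∀ i, ∀ z : ℂ, (JSQ.InteriorCurve (ρ : ℂ) z (P.β i : ℂ) ∧ ‖z‖ < P.β i) ↔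
        z = (P.α (i + 1) : ℂ)) ∧
      (∀ i, ∀ z : ℂ, (JSQ.InteriorCurve (ρ : ℂ) (P.α i : ℂ) z ∧ ‖z‖ < P.α i) ↔
        z = (P.β i : ℂ)) ∧
      -- the initial term, the vertical steps and the horizontal steps
      (JSQ.InteriorBalance ρ (P.hTerm 0) ∧ JSQ.HorizontalBalance ρ (P.hTerm 0)) ∧
      (∀ i, JSQ.InteriorBalance ρ (fun m n => P.hTerm i m n + P.vTerm i m n) ∧
        JSQ.VerticalBalance ρ (fun m n => P.hTerm i m n + P.vTerm i m n)) ∧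
      (∀ i, JSQ.InteriorBalance ρ (fun m n => P.vTerm i m n + P.hTerm (i + 1) m n) ∧
        JSQ.HorizontalBalance ρ (fun m n => P.vTerm i m n + P.hTerm (i + 1) m n)) ∧
      -- the limits of the ratios of consecutive terms
      (1 - JSQ.thetaMinus ρ) / (JSQ.thetaPlus ρ - 1) < 1 ∧
      (∀ m n : ℕ, 1 ≤ n →
        Tendsto (fun i => |P.hTerm (i + 1) m n / P.hTerm i m n|) atTop
          (𝓝 ((1 - JSQ.thetaMinus ρ) / (JSQ.thetaPlus ρ - 1) *
            (JSQ.thetaMinus ρ / JSQ.thetaPlus ρ) ^ (m + n - 1))) ∧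
        Tendsto (fun i => |P.vTerm (i + 1) m n / P.vTerm i m n|) atTop
          (𝓝 ((1 - JSQ.thetaMinus ρ) / (JSQ.thetaPlus ρ - 1) *
            (JSQ.thetaMinus ρ / JSQ.thetaPlus ρ) ^ (m + n - 1))) ∧
        (1 - JSQ.thetaMinus ρ) / (JSQ.thetaPlus ρ - 1) *
            (JSQ.thetaMinus ρ / JSQ.thetaPlus ρ) ^ (m + n - 1) < 1) ∧
      Tendsto (fun i =>
          (|P.h (i + 1)| / (1 - |P.α (i + 1)|) * (|P.β (i + 1)| / (1 - |P.β (i + 1)|))) /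
          (|P.h i| / (1 - |P.α i|) * (|P.β i| / (1 - |P.β i|)))) atTop
        (𝓝 ((1 - JSQ.thetaMinus ρ) / (JSQ.thetaPlus ρ - 1))) ∧
      Tendsto (fun i =>
          (|P.v (i + 1)| / (1 - |P.α (i + 2)|) * (|P.β (i + 1)| / (1 - |P.β (i + 1)|))) /
          (|P.v i| / (1 - |P.α (i + 1)|) * (|P.β i| / (1 - |P.β i|)))) atTop
        (𝓝 ((1 - JSQ.thetaMinus ρ) / (JSQ.thetaPlus ρ - 1))) ∧
      -- absolute convergence, for each state and summed over all states with `n ≥ 1`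
      (∀ m n : ℕ, 1 ≤ n →
        Summable (fun i => |P.hTerm i m n|) ∧ Summable (fun i => |P.vTerm i m n|)) ∧
      Summable (fun t : ℕ × ℕ × ℕ => |P.hTerm t.1 t.2.1 (t.2.2 + 1)|) ∧
      Summable (fun t : ℕ × ℕ × ℕ => |P.vTerm t.1 t.2.1 (t.2.2 + 1)|) ∧
      -- the series solves the balance equations and is, up to a constant factor,
      -- the only absolutely summable solution
      JSQ.InteriorBalance ρ P.series ∧ JSQ.VerticalBalance ρ P.series ∧
      JSQ.HorizontalBalance ρ P.series ∧ JSQ.CornerBalance ρ P.series ∧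
      (∃ m n : ℕ, 1 ≤ n ∧ P.series m n ≠ 0) ∧
      (∀ f : ℕ → ℕ → ℝ, Summable (fun s : ℕ × ℕ => |f s.1 (s.2 + 1)|) →
        JSQ.InteriorBalance ρ f → JSQ.VerticalBalance ρ f →
        JSQ.HorizontalBalance ρ f → JSQ.CornerBalance ρ f →
        ∃ c : ℝ, ∀ m n : ℕ, 1 ≤ n → f m n = c * P.series m n) ∧
      -- the normalization constant
      HasSum (JSQ.extend ρ P.series) (JSQ.normConst ρ) ∧
      -- the equilibrium distribution
      (∀ p : ℕ × ℤ → ℝ, JSQ.IsEquilibrium (JSQ.rateY ρ) p →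
        (∀ m n : ℕ, 1 ≤ n →
          p (m, (n : ℤ)) = (JSQ.normConst ρ)⁻¹ *
            ∑' i, (P.h i * P.α i ^ m + P.v i * P.α (i + 1) ^ m) * P.β i ^ n) ∧
        (∀ m n : ℕ, p (m, -(n : ℤ)) = p (m, (n : ℤ))) ∧
        (∀ m : ℕ, 1 ≤ m → p (m, 0) = (2 * ρ * p (m - 1, 1) + p (m, 1)) / (1 + ρ)) ∧
        p (0, 0) = p (0, 1) / ρ)) := by

  have hP₀ := JSQ.isCompensation_compParams hρ₀ hρ₁
  refine ⟨⟨_, hP₀, fun P hP => hP.eq_compParams hρ₀ hρ₁⟩,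
    ⟨_, (hP₀.isEquilibrium_rateY_iff hρ₀ hρ₁).2 rfl,
      fun p hp => (hP₀.isEquilibrium_rateY_iff hρ₀ hρ₁).1 hp⟩,
    ⟨_, (hP₀.isEquilibrium_rateX_iff hρ₀ hρ₁).2 rfl,
      fun p hp => (hP₀.isEquilibrium_rateX_iff hρ₀ hρ₁).1 hp⟩,
    JSQ.isEquilibrium_rateY_iff ρ, fun P hP => ?_⟩
  have R := hP.regular hρ₀ hρ₁
  have hα' := (tendsto_add_atTop_iff_nat 1).2 (R.tendsto_α hρ₀)
  have hαr' := (tendsto_add_atTop_iff_nat 1).2 (R.tendsto_α_succ_div hρ₀)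
  refine ⟨fun i => ⟨R.β_pos i, R.β_lt_α hρ₀ i, R.α_pos _, R.α_succ_lt i, R.α_lt_one i,
      (hP.h_v_ne hρ₀ hρ₁ i).1, (hP.h_v_ne hρ₀ hρ₁ i).2, R.horizontal_ne hρ₀ hP.α_zero i⟩,
    fun i z => ?_, fun i z => ?_, hP.initial_balance hρ₀ hρ₁, hP.vertical_step hρ₀ hρ₁,
    hP.horizontal_step hρ₀ hρ₁, JSQ.theta_ratio_lt_one hρ₀, fun m n hn => ⟨?_, ?_, ?_⟩, ?_, ?_,
    hP.summable_abs_terms hρ₀ hρ₁, hP.summable_abs_hTerm_triple hρ₀ hρ₁,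
    hP.summable_abs_vTerm_triple hρ₀ hρ₁, hP.interiorBalance_series hρ₀ hρ₁,
    hP.verticalBalance_series hρ₀ hρ₁, hP.horizontalBalance_series hρ₀ hρ₁,
    hP.cornerBalance_series hρ₀ hρ₁, hP.exists_series_ne_zero hρ₀ hρ₁,
    fun f hf hI hV hH hO => hP.eq_const_mul_series hρ₀ hρ₁ hf hI hV hH hO,
    hP.hasSum_extend_series hρ₀ hρ₁, fun p hp => hP.equilibrium_formulas hρ₀ hρ₁ hp⟩
  · rw [R.α_succ_eq]
    exact JSQ.interiorCurve_alpha_iff hρ₀ (R.β_pos i) (R.β_lt_one hρ₀ i) z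
  · rw [R.β_eq]
    exact JSQ.interiorCurve_beta_iff hρ₀ (R.α_pos i) (R.α_lt_one i) z
  · exact JSQ.tendsto_abs_term_ratio hρ₀ (hP.tendsto_h_succ_div hρ₀ hρ₁)
      (R.tendsto_α_succ_div hρ₀) (R.tendsto_β_succ_div hρ₀) m n hn
  · exact JSQ.tendsto_abs_term_ratio hρ₀ (a := fun i => P.α (i + 1))
      (hP.tendsto_v_succ_div hρ₀ hρ₁) hαr' (R.tendsto_β_succ_div hρ₀) m n hn
  · exact JSQ.theta_ratio_mul_pow_lt_one hρ₀ _
  · exact JSQ.tendsto_normalized_ratio hρ₀ R.α_pos R.β_pos R.α_lt_one (R.β_lt_one hρ₀)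
      (hP.tendsto_h_succ_div hρ₀ hρ₁) (R.tendsto_α hρ₀) (R.tendsto_β hρ₀)
      (R.tendsto_β_succ_div hρ₀)
  · exact JSQ.tendsto_normalized_ratio hρ₀ (a := fun i => P.α (i + 1)) (fun i => R.α_pos _)
      R.β_pos (fun i => R.α_lt_one _) (R.β_lt_one hρ₀) (hP.tendsto_v_succ_div hρ₀ hρ₁) hα'
      (R.tendsto_β hρ₀) (R.tendsto_β_succ_div hρ₀)
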